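/- Let $F$ be a field of characteristic different from $2$. A form means a regular (finite-dimensional, nondegenerate) quadratic form over $F$; $n\times q$ denotes the orthogonal sum of $n$ copies of $q$, and $p\subset q$ means that $q\simeq p\perp r$ for some (possibly zero-dimensional) form $r$. An $m$-fold Pfister form ($m\ge 0$) is a form isometric to $\langle 1,a_1\rangle\otimes\cdots\otimes\langle 1,a_m\rangle$ with $a_1,\dots,a_m\in F^\times$ (to $\langle 1\rangle$ if $m=0$). For a form $q$ over $F$ and a field extension $K/F$: - the $q$-level $s_q(K)$ is the least integer $n\ge 1$ such that $n\times q_K$ represents $-1$ over $K$, and $s_q(K)=\infty$ if there is no such $n$; - for a form $\psi$ over $F$, the $q$-length $\ell_q(\psi)$ is the least $n\in\mathbb{N}$ such that $\psi\subset n\times q$, and $\ell_q(\psi)=\infty$ if there is no such $n$; - $D_F(\varphi)$ is the set of elements of $F^\times$ represented by the form $\varphi$; - the function field $F(\varphi)$ is the field of fractions of $F[X_1,\dots,X_d]/(\varphi(X_1,\dots,X_d))$ if $d=\dim\varphi\ge 2$ and $\varphi\not\simeq\langle 1,-1\rangle$, and $F(\varphi)=F$ otherwise. **Proposition.** Let $q$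 be an anisotropic Pfister form over $F$ and let $\varphi$ be an anisotropic form over $F$ such that $\dim\varphi\le s_q(F)\cdot\dim q$ (a condition that holds automatically if $s_q(F)=\infty$). Let $r\ge 0$ be an integer. If $\ell_q(a\varphi)=n$ for some $a\in D_F(\varphi)$, where $2^r<n\le 2^{r+1}$, then $s_q(F(\varphi))=2^r$. -/

import Mathlib

open scoped TensorProduct

noncomputable section

namespace PfisterLevel

/-- `n × q`, the orthogonal sum of `n` copies of the quadratic form `q`. -/
def copies {R V : Type*} [CommRing R] [AddCommGroup V] [Module R V] (n : ℕ)
    (q : QuadraticForm R V) : QuadraticForm R (Fin n → V) :=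
  QuadraticMap.pi fun _ : Fin n => q

/-- `D_F(q)`, the set of nonzero values of `q`. -/
def valueSet {F V : Type*} [Field F] [AddCommGroup V] [Module F V]
    (q : QuadraticForm F V) : Set F :=
  {a | a ≠ 0 ∧ ∃ v, q v = a}

/-- The `q`-level: the least `n ≥ 1` such that `n × q` represents `-1`, and `⊤` if there is no
such `n`. -/
def level {R V : Type*} [CommRing R] [AddCommGroup V] [Module R V]
    (q : QuadraticForm R V) : ℕ∞ :=
  ⨅ (n : ℕ) (_ : 0 < n ∧ ∃ v, copies n q v = -1), (n : ℕ∞)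

/-- `p ⊂ q`: there is a regular quadratic form `r` (possibly of dimension zero; without loss of
generality on a coordinate space) with `q ≃ p ⊥ r`. -/
def IsSubform {F V W : Type*} [Field F] [AddCommGroup V] [Module F V] [AddCommGroup W]
    [Module F W] (p : QuadraticForm F V) (q : QuadraticForm F W) : Prop :=
  ∃ (m : ℕ) (r : QuadraticForm F (Fin m → F)), r.Nondegenerate ∧ q.Equivalent (p.prod r)

/-- The `q`-length of the form `p`: the least `n` with `p ⊂ n × q`, and `⊤` if there is no such
`n`. -/
def formLength {F V W : Type*} [Field F] [AddCommGroup V] [Module F V] [AddCommGroup W]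
    [Module F W] (q : QuadraticForm F V) (p : QuadraticForm F W) : ℕ∞ :=
  ⨅ (n : ℕ) (_ : IsSubform p (copies n q)), (n : ℕ∞)

/-- The diagonal form `⟨a, b⟩`. -/
def binary {F : Type*} [Field F] (a b : F) : QuadraticForm F (Fin 2 → F) :=
  QuadraticMap.weightedSumSquares F ![a, b]

/-- `⟨1, a₁⟩ ⊗ ⋯ ⊗ ⟨1, aₙ⟩` for a list `a₁, …, aₙ` of nonzero scalars; it is `⟨1⟩` for the empty
list. -/
def pfisterForm {F : Type*} [Field F] [Invertible (2 : F)] : List Fˣ → QuadraticModuleCat F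
  | [] => QuadraticModuleCat.of (QuadraticMap.sq (R := F))
  | a :: l => QuadraticModuleCat.of ((binary 1 (a : F)).tmul (pfisterForm l).form)

/-- `q` is an `n`-fold Pfister form for some `n ≥ 0`. -/
def IsPfister {F V : Type*} [Field F] [Invertible (2 : F)] [AddCommGroup V] [Module F V]
    (q : QuadraticForm F V) : Prop :=
  ∃ l : List Fˣ, q.Equivalent (pfisterForm l).form

section FunctionField

theorem eval_of_totalDegree_le_one {F ι : Type*} [Field F] (g : MvPolynomial ι F) (hg : g.totalDegree ≤ 1) :
    ∃ (c : F) (L : (ι → F) →ₗ[F] F), ∀ v, MvPolynomial.eval v g = c + L v := by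
  classical
  rw [← MvPolynomial.support_sum_monomial_coeff g]
  suffices h : ∀ d ∈ g.support, ∃ (c : F) (L : (ι → F) →ₗ[F] F), ∀ v,
      MvPolynomial.eval v (MvPolynomial.monomial d (g.coeff d)) = c + L v by
    choose! c L hL using h
    refine ⟨∑ d ∈ g.support, c d, ∑ d ∈ g.support, L d, fun v => ?_⟩
    rw [map_sum, LinearMap.sum_apply, ← Finset.sum_add_distrib]
    exact Finset.sum_congr rfl fun d hd => hL d hd v
  intro d hd
  have hd1 : d.degree ≤ 1 := (MvPolynomial.le_totalDegree hd).trans hg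
  rcases Nat.le_one_iff_eq_zero_or_eq_one.mp hd1 with h0 | h1
  · rw [Finsupp.degree_eq_zero_iff] at h0
    exact ⟨g.coeff d, 0, fun v => by simp [h0]⟩
  · obtain ⟨i, hi⟩ : ∃ i, d = Finsupp.single i 1 := by
      have hd0 : d ≠ 0 := by rintro rfl; simp at h1
      obtain ⟨i, hi⟩ := Finsupp.ne_iff.mp hd0
      have hle : Finsupp.single i 1 ≤ d :=
        Finsupp.single_le_iff.mpr (Nat.one_le_iff_ne_zero.mpr hi)
      obtain ⟨e, rfl⟩ := exists_add_of_le hle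
      have he : e = 0 := by
        rw [map_add, Finsupp.degree_single] at h1
        exact (Finsupp.degree_eq_zero_iff e).mp (by omega)
      exact ⟨i, by rw [he, add_zero]⟩
    exact ⟨0, g.coeff d • LinearMap.proj i, fun v => by simp [hi, MvPolynomial.eval_monomial]⟩

variable {F W ι : Type*} [Field F] [Invertible (2 : F)] [AddCommGroup W] [Module F W] [Fintype ι]

/-- The homogeneous polynomial `φ(∑ Xᵢ bᵢ)` of the quadratic form `φ` in the coordinates given by
the basis `b`. -/
def toPoly (φ : QuadraticForm F W) (b : Module.Basis ι F W) : MvPolynomial ι F :=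
  ∑ i, ∑ j, MvPolynomial.C (⅟2 * QuadraticMap.polar φ (b i) (b j)) *
    MvPolynomial.X i * MvPolynomial.X j

open Classical in
/-- The ideal `(φ(X))` of `F[X]` if `dim φ ≥ 2` and `φ` is not the hyperbolic plane; otherwise the
ideal of the origin, whose quotient is `F`. -/
def quadricIdeal (φ : QuadraticForm F W) (b : Module.Basis ι F W) : Ideal (MvPolynomial ι F) :=
  if 2 ≤ Module.finrank F W ∧ ¬ φ.Equivalent (binary (1 : F) (-1)) then
    Ideal.span {toPoly φ b}
  else Ideal.span (Set.range MvPolynomial.X)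

/-- The function field `F(φ)`: the field of fractions of `F[X₁, …, Xₙ] / (φ(X₁, …, Xₙ))` if
`dim φ ≥ 2` and `φ` is not the hyperbolic plane, and `F` (as the field of fractions of
`F[X₁, …, Xₙ] / (X₁, …, Xₙ)`) otherwise. -/
abbrev FunctionField (φ : QuadraticForm F W) (b : Module.Basis ι F W) : Type _ :=
  FractionRing (MvPolynomial ι F ⧸ quadricIdeal φ b)

/-- The polynomial `toPoly φ b` is indeed `φ` in the coordinates of `b`. -/
theorem eval_toPoly (φ : QuadraticForm F W) (b : Module.Basis ι F W) (v : ι → F) :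
    MvPolynomial.eval v (toPoly φ b) = φ (∑ i, v i • b i) := by
  have h : φ (∑ i, v i • b i) = QuadraticMap.associated φ (∑ i, v i • b i) (∑ i, v i • b i) :=
    (QuadraticMap.associated_eq_self_apply F φ _).symm
  rw [h, toPoly]
  simp only [map_sum, LinearMap.sum_apply, map_smul, LinearMap.smul_apply, map_mul,
    MvPolynomial.eval_C, MvPolynomial.eval_X, QuadraticMap.associated_apply, smul_eq_mul,
    Finset.mul_sum, QuadraticMap.polar]
  rw [Finset.sum_comm]
  refine Finset.sum_congr rfl fun i _ => Finset.sum_congr rfl fun j _ => ?_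
  have hs : ∀ x : F, (⅟2 : Module.End F F) • x = ⅟2 * x := by
    intro x
    simp
  rw [hs]
  ring

theorem toPoly_totalDegree_le (φ : QuadraticForm F W) (b : Module.Basis ι F W) :
    (toPoly φ b).totalDegree ≤ 2 := by
  refine MvPolynomial.totalDegree_finsetSum_le fun i _ =>
    MvPolynomial.totalDegree_finsetSum_le fun j _ => ?_
  refine (MvPolynomial.totalDegree_mul _ _).trans ?_
  refine (Nat.add_le_add_right (MvPolynomial.totalDegree_mul _ _) _).trans ?_
  rw [MvPolynomial.totalDegree_C, MvPolynomial.totalDegree_X, MvPolynomial.totalDegree_X]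

theorem toPoly_irreducible (φ : QuadraticForm F W) (hφ : φ.Anisotropic)
    (b : Module.Basis ι F W) (hd : 2 ≤ Module.finrank F W) : Irreducible (toPoly φ b) := by
  have hcard : Module.finrank F (ι → F) = Module.finrank F W := by
    rw [Module.finrank_eq_card_basis b, Module.finrank_fintype_fun_eq_card]
  have hker : ∀ L : (ι → F) →ₗ[F] F, ∃ v, v ≠ 0 ∧ L v = 0 := by
    intro L
    have hL : LinearMap.ker L ≠ ⊥ :=
      LinearMap.ker_ne_bot_of_finrank_lt (by rw [Module.finrank_self, hcard]; omega)
    obtain ⟨v, hv, hv0⟩ := (Submodule.ne_bot_iff _).mp hL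
    exact ⟨v, hv0, hv⟩
  have hval : ∀ v, MvPolynomial.eval v (toPoly φ b) = 0 → v = 0 := by
    intro v hv
    rw [eval_toPoly] at hv
    have h0 := hφ _ hv
    exact funext fun i => Fintype.linearIndependent_iff.mp b.linearIndependent v h0 i
  have hzero : MvPolynomial.eval 0 (toPoly φ b) = 0 := by
    rw [eval_toPoly]; simp
  have hne : toPoly φ b ≠ 0 := by
    intro h
    obtain ⟨v, hv, -⟩ := hker 0
    exact hv (hval v (by simp [h]))
  have hnu : ¬ IsUnit (toPoly φ b) := by
    intro h
    have := h.map (MvPolynomial.eval (0 : ι → F))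
    rw [hzero] at this
    exact not_isUnit_zero this
  refine ⟨hnu, fun {g h} hgh => ?_⟩
  have hg0 : g ≠ 0 := by rintro rfl; simp [hne] at hgh
  have hh0 : h ≠ 0 := by rintro rfl; simp [hne] at hgh
  have hdeg : g.totalDegree + h.totalDegree ≤ 2 := by
    rw [← MvPolynomial.totalDegree_mul_of_isDomain hg0 hh0, ← hgh]
    exact toPoly_totalDegree_le φ b
  have hunit : ∀ f : MvPolynomial ι F, f ≠ 0 → f.totalDegree = 0 → IsUnit f := by
    intro f hf hf0
    rw [MvPolynomial.totalDegree_eq_zero_iff_eq_C] at hf0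
    rw [hf0] at hf ⊢
    exact (IsUnit.mk0 _ fun h => hf (by rw [h, map_zero])).map MvPolynomial.C
  by_cases hgd : g.totalDegree = 0
  · exact Or.inl (hunit g hg0 hgd)
  by_cases hhd : h.totalDegree = 0
  · exact Or.inr (hunit h hh0 hhd)
  exfalso
  obtain ⟨c, L, hL⟩ := eval_of_totalDegree_le_one g (by omega)
  obtain ⟨d, M, hM⟩ := eval_of_totalDegree_le_one h (by omega)
  obtain ⟨v, hv, hLv⟩ := hker L
  have key : ∀ w, MvPolynomial.eval w (toPoly φ b) = (c + L w) * (d + M w) := by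
    intro w; rw [hgh, map_mul, hL, hM]
  have e0 : c * d = 0 := by
    have := key 0
    rw [hzero] at this
    simpa only [map_zero, add_zero] using this.symm
  have e1 := key v
  have e2 := key (-v)
  have e3 : MvPolynomial.eval (-v) (toPoly φ b) = MvPolynomial.eval v (toPoly φ b) := by
    simp only [eval_toPoly, Pi.neg_apply, neg_smul, Finset.sum_neg_distrib, QuadraticMap.map_neg]
  rw [e3] at e2
  simp only [map_neg, hLv] at e1 e2
  have h2 : (2 : F) ≠ 0 := Invertible.ne_zero 2
  refine hv (hval v ?_)
  have : (2 : F) * MvPolynomial.eval v (toPoly φ b) = 0 := by linear_combination e1 + e2 + 2 * e0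
  exact (mul_eq_zero.mp this).resolve_left h2

/-- The ideal defining the function field of an anisotropic form is prime. -/
theorem quadricIdeal_isPrime (φ : QuadraticForm F W) (hφ : φ.Anisotropic)
    (b : Module.Basis ι F W) : (quadricIdeal φ b).IsPrime := by
  unfold quadricIdeal
  split_ifs with h
  · have hi := toPoly_irreducible φ hφ b h.1
    rw [Ideal.span_singleton_prime hi.ne_zero]
    exact UniqueFactorizationMonoid.irreducible_iff_prime.mp hi
  · have hk : Ideal.span (Set.range (MvPolynomial.X (R := F) (σ := ι))) =
        RingHom.ker MvPolynomial.constantCoeff := by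
      ext p
      rw [RingHom.mem_ker, ← Set.image_univ, MvPolynomial.mem_ideal_span_X_image,
        MvPolynomial.constantCoeff_eq]
      refine ⟨fun hp => ?_, fun hp m hm => ?_⟩
      · by_contra h0
        obtain ⟨i, -, hi⟩ := hp 0 (MvPolynomial.mem_support_iff.mpr h0)
        exact hi rfl
      · by_contra! hc
        have : m = 0 := Finsupp.ext fun i => hc i (Set.mem_univ i)
        subst this
        exact MvPolynomial.mem_support_iff.mp hm hp
    rw [hk]
    exact RingHom.ker_isPrime _

/-- The function field of an anisotropic form is a field. -/
theorem functionField_isField (φ : QuadraticForm F W) (hφ : φ.Anisotropic)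
    (b : Module.Basis ι F W) : IsField (FunctionField φ b) := by
  have := quadricIdeal_isPrime φ hφ b
  exact Field.toIsField (FractionRing (MvPolynomial ι F ⧸ quadricIdeal φ b))

end FunctionField

end PfisterLevel

end

/-! Write `E` for the function field of `φ`. The form `2^r × q` is again a Pfister form, hence
round: its nonzero values are similarity factors, over `F` and over every extension.

Upper bound: `a φ` lies in `k × q` for some `k ≤ n ≤ 2^(r+1)`, and `φ` is isotropic over `E`, so
`2^(r+1) × q = 2^r × q ⊥ 2^r × q` is isotropic over `E`. By roundness `2^r × q` represents `-1`
there (`DiagRound.exists_diag_eq_neg_one`).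

Lower bound: if the level over `E` were below `2^r`, then `2^r × q` would be isotropic over `E`. If
it is isotropic over `F` already, then `2^(r-1) × q` represents `-1` over `F`, so `2^r × q` is
hyperbolic, and the dimension hypothesis makes room for `a φ` in it. If it is anisotropic over `F`,
it contains `a φ` by the argument below. Either way the length of `a φ` is at most `2^r < n`, a
contradiction.

The anisotropic case is a subform theorem. A zero over `E` is a vector of polynomials on which the
value of `2^r × q` is divisible by `φ(X)`. Reducing modulo `φ(X)` and specializing shows that `2^r ×
q` represents all values of `a φ` over every extension where it stays anisotropic
(`exists_diag_eq_of_dvd`). The Cassels–Pfister theorem over `K(X)` then splits off the diagonal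
entries of `a φ` one at a time (`RepresentsValues.exists_orthogonal`).

All forms are diagonalized, so that extension of scalars is composition of the coefficient family
with a ring homomorphism. -/

noncomputable section

namespace PfisterLevel

open Polynomial

/-! ### Diagonal bilinear forms over commutative rings -/

section Diagonal

variable {A B J : Type*} [CommRing A] [CommRing B] [Fintype J]

/-- The bilinear form with diagonal coefficients `d`. -/
def diag (d x y : J → A) : A := ∑ j, d j * x j * y j

theorem diag_comm (d x y : J → A) : diag d x y = diag d y x :=
  Finset.sum_congr rfl fun j _ => by ring

theorem diag_add_right (d x y z : J → A) : diag d x (y + z) = diag d x y + diag d x z := by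
  simp only [diag, Pi.add_apply, mul_add, Finset.sum_add_distrib]

theorem diag_smul_right (d x : J → A) (a : A) (y : J → A) : diag d x (a • y) = a * diag d x y := by
  simp only [diag, Pi.smul_apply, smul_eq_mul, Finset.mul_sum]
  exact Finset.sum_congr rfl fun j _ => by ring

theorem diag_add_left (d x y z : J → A) : diag d (x + y) z = diag d x z + diag d y z := by
  rw [diag_comm, diag_add_right, diag_comm d z x, diag_comm d z y]

theorem diag_smul_left (d x : J → A) (a : A) (y : J → A) : diag d (a • x) y = a * diag d x y := by
  rw [diag_comm, diag_smul_right, diag_comm]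

theorem diag_sub_right (d x y z : J → A) : diag d x (y - z) = diag d x y - diag d x z := by
  simp only [diag, Pi.sub_apply, mul_sub, Finset.sum_sub_distrib]

theorem diag_sub_left (d x y z : J → A) : diag d (x - y) z = diag d x z - diag d y z := by
  rw [diag_comm, diag_sub_right, diag_comm d z x, diag_comm d z y]

@[simp] theorem diag_zero_left (d y : J → A) : diag d 0 y = 0 := by simp [diag]

@[simp] theorem diag_zero_right (d y : J → A) : diag d y 0 = 0 := by simp [diag]

theorem diag_sum_right {I : Type*} (s : Finset I) (d x : J → A) (y : I → J → A) :
    diag d x (∑ i ∈ s, y i) = ∑ i ∈ s, diag d x (y i) := by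
  classical
  induction s using Finset.induction_on with
  | empty => simp
  | insert i s hi ih => rw [Finset.sum_insert hi, Finset.sum_insert hi, diag_add_right, ih]

theorem diag_sum_left {I : Type*} (s : Finset I) (d x : J → A) (y : I → J → A) :
    diag d (∑ i ∈ s, y i) x = ∑ i ∈ s, diag d (y i) x := by
  simp only [diag_comm d _ x, diag_sum_right]

theorem map_diag {H : Type*} [FunLike H A B] [RingHomClass H A B] (f : H) (d x y : J → A) :
    f (diag d x y) = diag (f ∘ d) (f ∘ x) (f ∘ y) := by
  simp [diag]

/-- The diagonal form with coefficients `d` has no nontrivial zero. -/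
def DiagAnisotropic (d : J → A) : Prop := ∀ x, diag d x x = 0 → x = 0

end Diagonal

/-! ### The Cassels–Pfister theorem and its consequence for quadratic polynomials -/

section CasselsPfister

variable {K J : Type*} [Field K] [Fintype J] {d : J → K}

theorem coeff_diag_C (d : J → K) (x : J → K[X]) (s : J → K) (n : ℕ) :
    (diag (C ∘ d) (C ∘ s) x).coeff n = diag d s fun j => (x j).coeff n := by
  simp only [diag, Function.comp_apply, finsetSum_coeff, ← C_mul, coeff_C_mul]

theorem coeff_two_mul_diag (d : J → K) (x : J → K[X]) (m : ℕ) (hm : ∀ j, (x j).natDegree ≤ m) :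
    (diag (C ∘ d) x x).coeff (2 * m) = diag d (fun j => (x j).coeff m) fun j => (x j).coeff m := by
  simp only [diag, Function.comp_apply, finsetSum_coeff]
  refine Finset.sum_congr rfl fun j _ => ?_
  rw [mul_assoc, coeff_C_mul, two_mul, coeff_mul_add_eq_of_natDegree_le (hm j) (hm j), mul_assoc]

/-- Leading terms cannot cancel: the vector of top coefficients would be a nontrivial zero of `d`.
-/
theorem DiagAnisotropic.natDegree_le (hd : DiagAnisotropic d) (x : J → K[X]) (k : ℕ)
    (hk : (diag (C ∘ d) x x).natDegree ≤ 2 * k) (j : J) : (x j).natDegree ≤ k := by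
  obtain ⟨m, hm⟩ : ∃ m, ∀ j, (x j).natDegree ≤ m :=
    ⟨Finset.univ.sup fun j => (x j).natDegree, fun j =>
      Finset.le_sup (f := fun j => (x j).natDegree) (Finset.mem_univ j)⟩
  induction m generalizing j with
  | zero => exact (hm j).trans (Nat.zero_le _)
  | succ m ih =>
    by_cases hmk : m + 1 ≤ k
    · exact (hm j).trans hmk
    · refine ih j fun i => ?_
      have h := coeff_two_mul_diag d x (m + 1) hm
      rw [coeff_eq_zero_of_natDegree_lt (by omega)] at h
      have h0 := congrFun (hd _ h.symm) i
      have := hm i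
      by_contra hlt
      have he : (x i).natDegree = m + 1 := by omega
      simp only [Pi.zero_apply] at h0
      rw [← he, coeff_natDegree, leadingCoeff_eq_zero] at h0
      rw [h0, natDegree_zero] at he
      omega

theorem DiagAnisotropic.polynomial (hd : DiagAnisotropic d) : DiagAnisotropic (C ∘ d) := by
  intro x hx
  have h := coeff_two_mul_diag d x 0 fun j => hd.natDegree_le x 0 (by simp [hx]) j
  rw [hx, coeff_zero] at h
  have h0 := hd _ h.symm
  funext j
  rw [eq_C_of_natDegree_le_zero (hd.natDegree_le x 0 (by simp [hx]) j)]
  simpa using congrFun h0 j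

theorem exists_common_denominator {J R L : Type*} [Finite J] [CommRing R] [IsDomain R] [CommRing L]
    [Algebra R L] [IsFractionRing R L] (v : J → L) :
    ∃ (x : J → R) (h : R), h ≠ 0 ∧ ∀ j, algebraMap R L (x j) = algebraMap R L h * v j := by
  obtain ⟨h, hh⟩ := IsLocalization.exist_integer_multiples_of_finite (nonZeroDivisors R) v
  choose x hx using hh
  exact ⟨x, h, nonZeroDivisors.ne_zero h.2, fun j => by rw [hx, Algebra.smul_def]⟩

theorem DiagAnisotropic.fractionRing {R L : Type*} [CommRing R] [IsDomain R] [Field L]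
    [Algebra R L] [IsFractionRing R L] {d : J → R} (hd : DiagAnisotropic d) :
    DiagAnisotropic (algebraMap R L ∘ d) := by
  intro v hv
  obtain ⟨x, h, h0, hx⟩ := exists_common_denominator (R := R) v
  have hx' : algebraMap R L ∘ x = algebraMap R L h • v := funext hx
  have hinj := IsFractionRing.injective R L
  have hz : x = 0 := hd _ (hinj (by
    rw [map_diag, hx', diag_smul_left, diag_smul_right, hv]; simp))
  funext j
  have := hx j
  rw [hz, Pi.zero_apply, map_zero] at this
  exact (mul_eq_zero.mp this.symm).resolve_left fun h' => h0 (hinj (by rw [h', map_zero]))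

/-- Reduction modulo `h` is `K`-linear, so it respects linear relations with constant coefficients,
and then so does the quotient. This keeps the polynomial parts in the Cassels–Pfister descent
orthogonal to `S`. -/
theorem diag_C_div_eq_zero (d s : J → K) (x : J → K[X]) (h : K[X]) (hh : h.Monic)
    (hx : diag (C ∘ d) (C ∘ s) x = 0) : diag (C ∘ d) (C ∘ s) (fun j => x j /ₘ h) = 0 := by
  have h1 : diag (C ∘ d) (C ∘ s) (fun j => x j %ₘ h) = 0 := by
    have : diag (C ∘ d) (C ∘ s) x %ₘ h = diag (C ∘ d) (C ∘ s) fun j => x j %ₘ h := by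
      have := map_sum (modByMonicHom h) (fun j => (d j * s j) • x j) Finset.univ
      simp only [modByMonicHom_apply, smul_modByMonic] at this
      simpa only [diag, Function.comp_apply, ← C_mul, smul_eq_C_mul] using this
    rw [← this, hx, zero_modByMonic]
  have h2 : x = (fun j => x j %ₘ h) + h • fun j => x j /ₘ h :=
    funext fun j => (modByMonic_add_div (x j) h).symm
  rw [h2, diag_add_right, h1, zero_add, diag_smul_right] at hx
  exact (mul_eq_zero.mp hx).resolve_left hh.ne_zero

/-- The Cassels–Pfister theorem: an anisotropic diagonal form over `K` that represents the
polynomial `p` over `K(X)` represents it over `K[X]`, and orthogonality to constant vectors can be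
preserved. -/
theorem cassels_pfister (hd : DiagAnisotropic d) (S : Set (J → K)) (p : K[X])
    (x : J → K[X]) (h : K[X]) (hh : h ≠ 0) (hx : diag (C ∘ d) x x = p * h ^ 2)
    (hS : ∀ s ∈ S, diag (C ∘ d) (C ∘ s) x = 0) :
    ∃ y : J → K[X], diag (C ∘ d) y y = p ∧ ∀ s ∈ S, diag (C ∘ d) (C ∘ s) y = 0 := by
  induction hn : h.natDegree using Nat.strong_induction_on generalizing x h with
  | _ n ih =>
  wlog hmon : h.Monic generalizing x h
  · refine this (C h.leadingCoeff⁻¹ • x) (h * C h.leadingCoeff⁻¹)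
      (monic_mul_leadingCoeff_inv hh).ne_zero ?_ (fun s hs => ?_) ?_
      (monic_mul_leadingCoeff_inv hh)
    · rw [diag_smul_left, diag_smul_right, hx]; ring
    · rw [diag_smul_right, hS s hs, mul_zero]
    · rw [natDegree_mul_leadingCoeff_inv _ hh, hn]
  set y : J → K[X] := fun j => x j /ₘ h with hy
  set z : J → K[X] := fun j => x j %ₘ h with hz
  have hyS : ∀ s ∈ S, diag (C ∘ d) (C ∘ s) y = 0 := fun s hs =>
    diag_C_div_eq_zero d s x h hmon (hS s hs)
  have hxyz : x = z + h • y := funext fun j => (modByMonic_add_div (x j) h).symm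
  by_cases hz0 : z = 0
  · refine ⟨y, ?_, hyS⟩
    rw [hxyz, hz0, zero_add, diag_smul_left, diag_smul_right] at hx
    have : h ^ 2 * (diag (C ∘ d) y y - p) = 0 := by linear_combination hx
    exact sub_eq_zero.mp ((mul_eq_zero.mp this).resolve_left (pow_ne_zero 2 hh))
  have hQz : diag (C ∘ d) z z ≠ 0 := fun h0 => hz0 (hd.polynomial _ h0)
  -- Descent on the denominator: the line through `x / h` and its polynomial part `y` meets the
  -- quadric `d = p` in a second point, with denominator `h'`. As `d(z) = h h'` and the remainder
  -- `z` has degree below `h`, the degree of `h'` is smaller than that of `h`.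
  set h' := p * h - 2 * diag (C ∘ d) x y + h * diag (C ∘ d) y y with hh'
  have hz' : z = x - h • y := by rw [eq_sub_iff_add_eq]; exact hxyz.symm
  have hprod : diag (C ∘ d) z z = h * h' := by
    rw [hz', diag_sub_left, diag_sub_right, diag_sub_right, diag_smul_left, diag_smul_right,
      diag_smul_left, diag_smul_right, hx, diag_comm _ y x]
    ring
  have hh'0 : h' ≠ 0 := by rintro h0; rw [h0, mul_zero] at hprod; exact hQz hprod
  have hn0 : 0 < n := by
    rw [← hn]
    by_contra hc
    have h1 : h = 1 := hmon.natDegree_eq_zero.mp (by omega)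
    exact hz0 (funext fun j => by simp [hz, h1])
  have hzdeg : ∀ j, (z j).natDegree ≤ n - 1 := fun j => by
    have : (x j %ₘ h).natDegree < h.natDegree :=
      natDegree_modByMonic_lt _ hmon (by rintro rfl; simp at hn; omega)
    show (x j %ₘ h).natDegree ≤ n - 1
    omega
  have hdeg : (diag (C ∘ d) z z).natDegree ≤ 2 * (n - 1) := by
    refine natDegree_sum_le_of_forall_le _ _ fun j _ => ?_
    refine natDegree_mul_le.trans ?_
    have h1 := natDegree_C_mul_le (d j) (z j)
    have h2 := hzdeg j
    simp only [Function.comp_apply]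
    omega
  rw [hprod, natDegree_mul hh hh'0, hn] at hdeg
  refine ih h'.natDegree (by omega)
    ((diag (C ∘ d) y y - p) • x + (2 * (p * h - diag (C ∘ d) x y)) • y) h' hh'0 ?_ ?_ rfl
  · rw [diag_add_left, diag_add_right, diag_add_right]
    simp only [diag_smul_left, diag_smul_right]
    rw [hx, diag_comm _ y x, hh']
    ring
  · intro s hs
    rw [diag_add_right, diag_smul_right, diag_smul_right, hS s hs, hyS s hs]
    ring

theorem cassels_pfister_fractionRing {L : Type*} [Field L] [Algebra K[X] L]
    [IsFractionRing K[X] L] (hd : DiagAnisotropic d) (S : Set (J → K)) (p : K[X]) (v : J → L)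
    (hv : diag (algebraMap K[X] L ∘ C ∘ d) v v = algebraMap K[X] L p)
    (hS : ∀ s ∈ S, diag (algebraMap K[X] L ∘ C ∘ d) (algebraMap K[X] L ∘ C ∘ s) v = 0) :
    ∃ y : J → K[X], diag (C ∘ d) y y = p ∧ ∀ s ∈ S, diag (C ∘ d) (C ∘ s) y = 0 := by
  obtain ⟨x, h, h0, hx⟩ := exists_common_denominator (R := K[X]) v
  have hx' : algebraMap K[X] L ∘ x = algebraMap K[X] L h • v := funext hx
  have hinj := IsFractionRing.injective K[X] L
  refine cassels_pfister hd S p x h h0 (hinj ?_) fun s hs => hinj ?_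
  · rw [map_diag, hx', diag_smul_left, diag_smul_right, hv, map_mul, map_pow]
    ring
  · rw [map_diag, hx', diag_smul_right, hS s hs, mul_zero, map_zero]

/-- A quadratic polynomial `a X² + b` represented over `K[X]` by an anisotropic form over `K` is
represented by orthogonal vectors with values `a` and `b`. -/
theorem exists_orthogonal_of_diag_eq_quadratic (hd : DiagAnisotropic d) (S : Set (J → K)) (a b : K)
    (y : J → K[X]) (hy : diag (C ∘ d) y y = C a * X ^ 2 + C b)
    (hS : ∀ s ∈ S, diag (C ∘ d) (C ∘ s) y = 0) (h2 : (2 : K) ≠ 0) :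
    ∃ u v : J → K, diag d u u = a ∧ diag d v v = b ∧ diag d u v = 0 ∧
      (∀ s ∈ S, diag d s u = 0) ∧ ∀ s ∈ S, diag d s v = 0 := by
  have hdeg : ∀ j, (y j).natDegree ≤ 1 := hd.natDegree_le y 1 (by rw [hy]; compute_degree)
  set u : J → K := fun j => (y j).coeff 1
  set v : J → K := fun j => (y j).coeff 0
  have hyuv : y = C ∘ v + (X : K[X]) • (C ∘ u) := funext fun j => by
    conv_lhs => rw [eq_X_add_C_of_natDegree_le_one (hdeg j)]
    simp [u, v]; ring
  have hexp : C a * X ^ 2 + C b =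
      C (diag d u u) * X ^ 2 + C (2 * diag d u v) * X + C (diag d v v) := by
    rw [← hy]
    conv_lhs => rw [hyuv]
    rw [diag_add_left, diag_add_right, diag_add_right]
    simp only [diag_smul_left, diag_smul_right, ← map_diag, map_mul, map_ofNat, diag_comm d v u]
    ring
  have e0 := congrArg (fun p => coeff p 0) hexp
  have e1 := congrArg (fun p => coeff p 1) hexp
  have e2 := congrArg (fun p => coeff p 2) hexp
  simp [coeff_X, coeff_C, coeff_X_pow] at e0 e1 e2
  refine ⟨u, v, e2.symm, e0.symm, ?_, fun s hs => ?_, fun s hs => ?_⟩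
  · exact e1.resolve_left h2
  · have := congrArg (fun p => coeff p 1) (hS s hs)
    simpa only [coeff_diag_C, coeff_zero] using this
  · have := congrArg (fun p => coeff p 0) (hS s hs)
    simpa only [coeff_diag_C, coeff_zero] using this

/-- Two vectors with the same value are interchanged by a reflection; it carries a vector `v`
orthogonal to the first to a vector orthogonal to the second. -/
theorem exists_orthogonal_of_diag_eq (hd : DiagAnisotropic d) (S : Set (J → K)) (u x v : J → K)
    (hux : diag d u u = diag d x x) (huv : diag d u v = 0) (hSu : ∀ s ∈ S, diag d s u = 0)
    (hSx : ∀ s ∈ S, diag d s x = 0) (hSv : ∀ s ∈ S, diag d s v = 0) :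
    ∃ v', diag d v' v' = diag d v v ∧ ∀ s ∈ insert x S, diag d s v' = 0 := by
  by_cases hz : u - x = 0
  · refine ⟨v, rfl, ?_⟩
    rintro s (rfl | hs)
    · rwa [← sub_eq_zero.mp hz]
    · exact hSv s hs
  have hQ : diag d (u - x) (u - x) ≠ 0 := fun h => hz (hd _ h)
  have hQ' : diag d (u - x) (u - x) = 2 * diag d x x - 2 * diag d u x := by
    rw [diag_sub_left, diag_sub_right, diag_sub_right, hux, diag_comm d x u]; ring
  -- The image of `v` under the reflection in `u - x`, which exchanges `u` and `x` and fixes vectors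
  -- orthogonal to both.
  refine ⟨v - (2 * diag d v (u - x) / diag d (u - x) (u - x)) • (u - x), ?_, ?_⟩
  · rw [diag_sub_left, diag_sub_right d v, diag_sub_right d (_ • _)]
    simp only [diag_smul_left, diag_smul_right]
    rw [diag_comm d (u - x) v]
    field_simp
    ring
  · rintro s (rfl | hs)
    · rw [diag_sub_right, diag_smul_right, diag_sub_right d v, diag_sub_right d s,
        diag_comm d v u, huv, diag_comm d s u, diag_comm d v s]
      rw [div_mul_eq_mul_div, sub_eq_zero, eq_div_iff hQ, hQ']
      ring
    · rw [diag_sub_right, diag_smul_right, diag_sub_right d s u, hSu s hs, hSx s hs, hSv s hs]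
      ring

end CasselsPfister

/-! ### The subform theorem -/

section Descent

universe u

variable {F : Type u} [Field F] {J : Type*} [Fintype J]

/-- Over every extension field over which the diagonal form `d` stays anisotropic, `d` represents
all values of the diagonal form `c`, by vectors orthogonal to `S`. -/
def RepresentsValues (d : J → F) (S : Set (J → F)) {m : ℕ} (c : Fin m → F) : Prop :=
  ∀ (K : Type u) [Field K] [Algebra F K], DiagAnisotropic (algebraMap F K ∘ d) →
    ∀ w : Fin m → K, ∃ v : J → K,
      diag (algebraMap F K ∘ d) v v = diag (algebraMap F K ∘ c) w w ∧
      ∀ s ∈ S, diag (algebraMap F K ∘ d) (algebraMap F K ∘ s) v = 0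

theorem RepresentsValues.exists_vector {d : J → F} {S : Set (J → F)} {m : ℕ} {c : Fin m → F}
    (hc : RepresentsValues d S c) (hd : DiagAnisotropic d) (w : Fin m → F) :
    ∃ v : J → F, diag d v v = diag c w w ∧ ∀ s ∈ S, diag d s v = 0 :=
  hc F hd w

/-- Taking an indeterminate as first coordinate over `K(X)`, `d` represents `c₀ X² + c'(w)`, where
`c'` is the tail. By Cassels–Pfister this comes from orthogonal vectors over `K` with values `c₀`
and `c'(w)`; a reflection moves the first onto the given `x`. Recording `x` in `S` replaces passing
to its orthogonal complement. -/
theorem RepresentsValues.tail (h2 : (2 : F) ≠ 0) {d : J → F} {S : Set (J → F)} {m : ℕ}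
    {c : Fin (m + 1) → F} (hc : RepresentsValues d S c) {x : J → F} (hx : diag d x x = c 0)
    (hSx : ∀ s ∈ S, diag d s x = 0) : RepresentsValues d (insert x S) (Fin.tail c) := by
  intro K _ _ hK w
  let L := FractionRing K[X]
  have hFL : algebraMap F L = (algebraMap K[X] L).comp (C.comp (algebraMap F K)) := rfl
  have hL : DiagAnisotropic (algebraMap F L ∘ d) := hK.polynomial.fractionRing (L := L)
  obtain ⟨v, hv, hSv⟩ := hc L hL (Fin.cons (algebraMap K[X] L X) (algebraMap K[X] L ∘ C ∘ w))
  have h2K : (2 : K) ≠ 0 := by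
    rw [← map_ofNat (algebraMap F K)]
    exact (_root_.map_ne_zero _).mpr h2
  obtain ⟨y, hy, hSy⟩ := cassels_pfister_fractionRing (L := L) hK ((algebraMap F K ∘ ·) '' S)
    (C (algebraMap F K (c 0)) * X ^ 2 + C (diag (algebraMap F K ∘ Fin.tail c) w w)) v
    (by
      refine hv.trans ?_
      rw [map_diag C, map_add, map_diag]
      simp only [diag, Fin.sum_univ_succ, hFL, Fin.cons_zero, Fin.cons_succ]
      simp [Fin.tail]
      ring)
    (by rintro _ ⟨s, hs, rfl⟩; exact hSv s hs)
  obtain ⟨v1, v0, h1, h0, h10, hS1, hS0⟩ :=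
    exists_orthogonal_of_diag_eq_quadratic hK _ _ _ y hy hSy h2K
  obtain ⟨v', hv', hSv'⟩ := exists_orthogonal_of_diag_eq hK _ v1 (algebraMap F K ∘ x) v0
    (by rw [h1, ← map_diag, hx]) h10 hS1
    (by rintro _ ⟨s, hs, rfl⟩; rw [← map_diag, hSx s hs, map_zero]) hS0
  refine ⟨v', hv'.trans h0, ?_⟩
  rintro s (rfl | hs)
  · exact hSv' _ (Set.mem_insert _ _)
  · exact hSv' _ (Set.mem_insert_of_mem _ ⟨s, hs, rfl⟩)

/-- The subform theorem: an anisotropic diagonal form that represents all values of another form,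
over sufficiently many extensions, contains that form. -/
theorem RepresentsValues.exists_orthogonal (h2 : (2 : F) ≠ 0) {d : J → F}
    (hd : DiagAnisotropic d) {S : Set (J → F)} {m : ℕ} {c : Fin m → F}
    (hc : RepresentsValues d S c) :
    ∃ g : Fin m → J → F, (∀ i, diag d (g i) (g i) = c i) ∧
      (∀ i j, i ≠ j → diag d (g i) (g j) = 0) ∧ ∀ i, ∀ s ∈ S, diag d s (g i) = 0 := by
  induction m generalizing S with
  | zero => exact ⟨Fin.elim0, fun i => i.elim0, fun i => i.elim0, fun i => i.elim0⟩
  | succ m ih =>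
    obtain ⟨x, hx, hSx⟩ := hc.exists_vector hd (Pi.single 0 1)
    have hx0 : diag d x x = c 0 := by rw [hx]; simp [diag, Fin.sum_univ_succ]
    obtain ⟨g, hg, hgo, hgS⟩ := ih (hc.tail h2 hx0 hSx)
    refine ⟨Fin.cons x g, fun i => ?_, fun i j hij => ?_, fun i => ?_⟩
    · refine Fin.cases ?_ (fun i => ?_) i
      · simpa using hx0
      · simpa [Fin.tail] using hg i
    · revert hij
      refine Fin.cases ?_ (fun i => ?_) i <;> refine Fin.cases ?_ (fun j => ?_) j <;> intro hij
      · exact absurd rfl hij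
      · simpa using hgS j x (Set.mem_insert _ _)
      · simpa [diag_comm d (g i) x] using hgS i x (Set.mem_insert _ _)
      · simpa using hgo i j fun h => hij (by rw [h])
    · refine Fin.cases ?_ (fun i => ?_) i
      · simpa using hSx
      · intro s hs
        simpa using hgS i s (Set.mem_insert_of_mem _ hs)

end Descent

/-! ### From divisibility by a form to representation of its values -/

section Specialization

variable {J : Type*}

/-- A nonzero family of polynomials is a multiple, by a power of `X - c`, of a family that does not
vanish at `c`. -/
theorem exists_eq_pow_smul_eval_ne_zero {A I : Type*} [CommRing A] [IsDomain A] (c : A)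
    (z : I → A[X]) (hz : z ≠ 0) :
    ∃ (k : ℕ) (z' : I → A[X]), z = (X - C c) ^ k • z' ∧ (fun i => (z' i).eval c) ≠ 0 := by
  obtain ⟨i, hi⟩ := Function.ne_iff.mp hz
  rw [Pi.zero_apply] at hi
  induction hn : (z i).natDegree using Nat.strong_induction_on generalizing z with
  | _ n ih =>
  by_cases h0 : (fun i => (z i).eval c) = 0
  · have hdvd : ∀ j, X - C c ∣ z j := fun j => dvd_iff_isRoot.mpr (congrFun h0 j)
    choose y hy using hdvd
    have hyi : y i ≠ 0 := fun h => hi (by rw [hy, h, mul_zero])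
    have hdeg : (z i).natDegree = 1 + (y i).natDegree := by
      rw [hy i, natDegree_mul (X_sub_C_ne_zero c) hyi, natDegree_X_sub_C]
    obtain ⟨k, z', h1, h2⟩ := ih (y i).natDegree (by omega) y
      (fun h => hyi (by rw [h]; rfl)) hyi rfl
    refine ⟨k + 1, z', ?_, h2⟩
    funext j
    rw [hy j, h1, Pi.smul_apply, Pi.smul_apply, smul_eq_mul, smul_eq_mul]
    ring
  · exact ⟨0, z, by simp, h0⟩

variable [Fintype J]

/-- Nontrivial solutions of the homogeneous system `d(u) = p d(w)`, `d(u, w) = 0` with polynomial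
coefficient `p` specialize to nontrivial solutions. -/
theorem exists_specialization {K : Type*} [Field K] (d : J → K) {m : ℕ}
    (p : MvPolynomial (Fin m) K) (u w : J → MvPolynomial (Fin m) K) (huw : ¬(u = 0 ∧ w = 0))
    (h1 : diag (MvPolynomial.C ∘ d) u u = p * diag (MvPolynomial.C ∘ d) w w)
    (h2 : diag (MvPolynomial.C ∘ d) u w = 0) (c : Fin m → K) :
    ∃ u' w' : J → K, ¬(u' = 0 ∧ w' = 0) ∧
      diag d u' u' = MvPolynomial.eval c p * diag d w' w' ∧ diag d u' w' = 0 := by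
  induction m with
  | zero =>
    have hinj : Function.Injective (MvPolynomial.eval c) := fun f g hfg => by
      rw [MvPolynomial.eq_C_of_isEmpty f, MvPolynomial.eq_C_of_isEmpty g] at hfg ⊢
      simpa using hfg
    have hd : MvPolynomial.eval c ∘ MvPolynomial.C ∘ d = d := by funext j; simp
    refine ⟨MvPolynomial.eval c ∘ u, MvPolynomial.eval c ∘ w, fun h => huw ⟨?_, ?_⟩, ?_, ?_⟩
    · exact funext fun j => hinj (by simpa using congrFun h.1 j)
    · exact funext fun j => hinj (by simpa using congrFun h.2 j)
    · simpa [map_diag, hd] using congrArg (MvPolynomial.eval c) h1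
    · simpa [map_diag, hd] using congrArg (MvPolynomial.eval c) h2
  | succ m ih =>
    set e := MvPolynomial.finSuccEquiv K m
    have he : e ∘ MvPolynomial.C ∘ d = C ∘ MvPolynomial.C ∘ d := by
      funext j
      simp [e, MvPolynomial.finSuccEquiv_apply]
    -- The common power of `X - c 0` is removed from `u` and `w` jointly, so that they do not both
    -- vanish on evaluation. The equations are homogeneous and survive the division.
    obtain ⟨k, z, hz, hz0⟩ := exists_eq_pow_smul_eval_ne_zero (MvPolynomial.C (c 0))
      (Sum.elim (e ∘ u) (e ∘ w)) (fun h => huw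
        ⟨funext fun j => e.injective (by simpa using congrFun h (Sum.inl j)),
          funext fun j => e.injective (by simpa using congrFun h (Sum.inr j))⟩)
    set q := (X - C (MvPolynomial.C (c 0)) : (MvPolynomial (Fin m) K)[X]) ^ k with hq
    have hq0 : q ≠ 0 := pow_ne_zero _ (X_sub_C_ne_zero _)
    have hu : e ∘ u = q • (z ∘ Sum.inl) := funext fun j => congrFun hz (Sum.inl j)
    have hw : e ∘ w = q • (z ∘ Sum.inr) := funext fun j => congrFun hz (Sum.inr j)
    have hev : evalRingHom (MvPolynomial.C (c 0) : MvPolynomial (Fin m) K) ∘ C ∘ MvPolynomial.C ∘ d =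
        MvPolynomial.C ∘ d := by funext j; simp
    have k1 : diag (C ∘ MvPolynomial.C ∘ d) (z ∘ Sum.inl) (z ∘ Sum.inl) =
        e p * diag (C ∘ MvPolynomial.C ∘ d) (z ∘ Sum.inr) (z ∘ Sum.inr) := by
      have := congrArg e h1
      rw [map_mul, map_diag, map_diag] at this
      simp only [he, hu, hw, diag_smul_left, diag_smul_right] at this
      exact mul_left_cancel₀ (mul_ne_zero hq0 hq0) (by linear_combination this)
    have k2 : diag (C ∘ MvPolynomial.C ∘ d) (z ∘ Sum.inl) (z ∘ Sum.inr) = 0 := by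
      have := congrArg e h2
      rw [map_diag] at this
      simp only [he, hu, hw, diag_smul_left, diag_smul_right, map_zero] at this
      simpa [hq0] using this
    have l1 := congrArg (evalRingHom (MvPolynomial.C (c 0))) k1
    have l2 := congrArg (evalRingHom (MvPolynomial.C (c 0))) k2
    rw [map_mul, map_diag, map_diag, hev] at l1
    rw [map_diag, hev, map_zero] at l2
    obtain ⟨u', w', h0, r1, r2⟩ := ih _ _ _ (fun h => hz0 (by
      funext i
      rcases i with j | j
      · exact congrFun h.1 j
      · exact congrFun h.2 j)) l1 l2 (Fin.tail c)
    refine ⟨u', w', h0, ?_, r2⟩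
    rw [r1]
    congr 1
    have hc0 : c 0 = MvPolynomial.eval (Fin.tail c) (MvPolynomial.C (c 0)) := by simp
    conv_rhs => rw [← Fin.cons_self_tail c, MvPolynomial.eval_eq_eval_mv_eval', hc0,
      Polynomial.eval_map, Polynomial.eval₂_at_apply]
    rfl

theorem finSuccEquiv_diag {F : Type*} [Field F] {m : ℕ} (c : Fin (m + 1) → F) :
    MvPolynomial.finSuccEquiv F m (diag (MvPolynomial.C ∘ c) MvPolynomial.X MvPolynomial.X) =
      C (MvPolynomial.C (c 0)) * X ^ 2 +
        C (diag (MvPolynomial.C ∘ Fin.tail c) MvPolynomial.X MvPolynomial.X) := by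
  simp only [diag, Fin.sum_univ_succ, map_add, map_mul, map_sum, Function.comp_apply,
    MvPolynomial.finSuccEquiv_X_zero, MvPolynomial.finSuccEquiv_X_succ, Fin.tail]
  simp [MvPolynomial.finSuccEquiv_apply]
  ring

/-- The form has degree two in the first variable because `c 0 ≠ 0`. -/
theorem not_diag_dvd_X_zero {F : Type*} [Field F] {m : ℕ} {c : Fin (m + 1) → F} (hc : c 0 ≠ 0) :
    ¬diag (MvPolynomial.C ∘ c) MvPolynomial.X MvPolynomial.X ∣
      (MvPolynomial.X 0 : MvPolynomial (Fin (m + 1)) F) := by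
  rw [← map_dvd_iff (MvPolynomial.finSuccEquiv F m), finSuccEquiv_diag,
    MvPolynomial.finSuccEquiv_X_zero]
  intro h
  have h1 := natDegree_le_of_dvd h X_ne_zero
  rw [natDegree_add_C, natDegree_C_mul_X_pow 2 _
    ((map_ne_zero_iff _ (MvPolynomial.C_injective _ _)).mpr hc), natDegree_X] at h1
  omega

/-- If the form `c` divides `d(v)` for a vector `v` of polynomials it does not divide, then the form
`c₀⁻¹ c` has only values that are values of `d`, over every extension over which `d` is anisotropic
and has a multiplicative set of values. -/
theorem exists_diag_eq_of_dvd {F K : Type*} [Field F] [Field K] [Algebra F K] (h2 : (2 : F) ≠ 0)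
    {m : ℕ} {d : J → F} {c : Fin (m + 1) → F} (hc : c 0 ≠ 0)
    (v : J → MvPolynomial (Fin (m + 1)) F)
    (hv : diag (MvPolynomial.C ∘ c) MvPolynomial.X MvPolynomial.X ∣ diag (MvPolynomial.C ∘ d) v v)
    (hnv : ¬∀ j, diag (MvPolynomial.C ∘ c) MvPolynomial.X MvPolynomial.X ∣ v j)
    (hK : DiagAnisotropic (algebraMap F K ∘ d))
    (hmul : ∀ x y : J → K, ∃ z, diag (algebraMap F K ∘ d) z z =
      diag (algebraMap F K ∘ d) x x * diag (algebraMap F K ∘ d) y y) (w : Fin (m + 1) → K) :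
    ∃ v' : J → K, diag (algebraMap F K ∘ d) v' v' =
      (algebraMap F K (c 0))⁻¹ * diag (algebraMap F K ∘ c) w w := by
  set e := MvPolynomial.finSuccEquiv F m
  set Φ : MvPolynomial (Fin (m + 1)) F := diag (MvPolynomial.C ∘ c) MvPolynomial.X MvPolynomial.X
  have he : e ∘ MvPolynomial.C ∘ d = C ∘ MvPolynomial.C ∘ d := by
    funext j
    simp [e, MvPolynomial.finSuccEquiv_apply]
  set δ : MvPolynomial (Fin m) F := MvPolynomial.C (c 0)⁻¹ *
    diag (MvPolynomial.C ∘ Fin.tail c) MvPolynomial.X MvPolynomial.X with hδ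
  set Ψ : (MvPolynomial (Fin m) F)[X] := X ^ 2 + C δ with hΨ
  have hΨm : Ψ.Monic := monic_X_pow_add_C δ two_ne_zero
  have hΨd : Ψ.natDegree = 2 := natDegree_X_pow_add_C
  have hcc : (MvPolynomial.C (c 0) : MvPolynomial (Fin m) F) * MvPolynomial.C (c 0)⁻¹ = 1 := by
    rw [← MvPolynomial.C_mul, mul_inv_cancel₀ hc, MvPolynomial.C_1]
  have hΦ : e Φ = C (MvPolynomial.C (c 0)) * Ψ := by
    rw [finSuccEquiv_diag, hΨ, mul_add, ← C_mul, hδ, ← mul_assoc, hcc, one_mul]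
  have hΨΦ : Associated Ψ (e Φ) := by
    rw [hΦ]
    exact associated_unit_mul_right _ _ (((IsUnit.mk0 _ hc).map MvPolynomial.C).map C)
  -- Modulo the monic `Ψ = X² + δ`, proportional to the form `c`, the vector `v` becomes `u + X t`.
  set u : J → MvPolynomial (Fin m) F := fun j => (e (v j) %ₘ Ψ).coeff 0
  set t : J → MvPolynomial (Fin m) F := fun j => (e (v j) %ₘ Ψ).coeff 1
  have hr : ∀ j, e (v j) %ₘ Ψ = C (u j) + X * C (t j) := fun j => by
    have : (e (v j) %ₘ Ψ).natDegree ≤ 1 := by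
      have := natDegree_modByMonic_lt (e (v j)) hΨm (by
        intro h; rw [h, natDegree_one] at hΨd; omega)
      omega
    conv_lhs => rw [eq_X_add_C_of_natDegree_le_one this]
    simp only [u, t]
    ring
  have hV : e ∘ v = (C ∘ u + (X : (MvPolynomial (Fin m) F)[X]) • (C ∘ t)) +
      Ψ • fun j => e (v j) /ₘ Ψ := funext fun j => by
    simp only [Function.comp_apply, Pi.add_apply, Pi.smul_apply, smul_eq_mul, ← hr]
    exact (modByMonic_add_div _ _).symm
  have hut : ¬(u = 0 ∧ t = 0) := fun h => hnv fun j => by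
    rw [← map_dvd_iff e, ← hΨΦ.dvd_iff_dvd_left, ← modByMonic_eq_zero_iff_dvd hΨm, hr, h.1, h.2]
    simp
  have hdvd : Ψ ∣ diag (C ∘ MvPolynomial.C ∘ d) (C ∘ u + (X : (MvPolynomial (Fin m) F)[X]) • (C ∘ t))
      (C ∘ u + (X : (MvPolynomial (Fin m) F)[X]) • (C ∘ t)) := by
    have h := _root_.map_dvd e hv
    rw [map_diag e _ v v] at h
    simp only [he, hV] at h
    rw [← hΨΦ.dvd_iff_dvd_left, diag_add_left, diag_add_right, diag_smul_left,
      diag_smul_right (y := fun j => e (v j) /ₘ Ψ), add_assoc, ← mul_add] at h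
    exact (dvd_add_left (dvd_mul_right _ _)).mp h
  have hexp : diag (C ∘ MvPolynomial.C ∘ d) (C ∘ u + (X : (MvPolynomial (Fin m) F)[X]) • (C ∘ t))
      (C ∘ u + (X : (MvPolynomial (Fin m) F)[X]) • (C ∘ t)) =
      Ψ * C (diag (MvPolynomial.C ∘ d) t t) + (C (2 * diag (MvPolynomial.C ∘ d) u t) * X +
        C (diag (MvPolynomial.C ∘ d) u u - δ * diag (MvPolynomial.C ∘ d) t t)) := by
    rw [diag_add_left, diag_add_right, diag_add_right]
    simp only [diag_smul_left, diag_smul_right, map_sub, map_mul, map_ofNat]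
    simp only [map_diag, hΨ, diag_comm _ (C ∘ t) (C ∘ u)]
    ring
  -- Replacing `X²` by `Ψ - δ` leaves a multiple of `Ψ` of degree at most one, which is zero. Hence
  -- `d(u) = δ d(t)` and `d(u, t) = 0`.
  rw [hexp, dvd_add_right (dvd_mul_right _ _)] at hdvd
  have hzero := eq_zero_of_dvd_of_natDegree_lt hdvd (by
    rw [hΨd]; exact lt_of_le_of_lt natDegree_linear_le one_lt_two)
  have e0 := congrArg (fun p => coeff p 0) hzero
  have e1 := congrArg (fun p => coeff p 1) hzero
  simp only [coeff_add, coeff_C_mul, coeff_X_zero, coeff_X_one, mul_zero, zero_add, mul_one,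
    coeff_C_zero, coeff_C_succ, add_zero, coeff_zero] at e0 e1
  have h2' : (2 : MvPolynomial (Fin m) F) ≠ 0 := by
    rw [← map_ofNat MvPolynomial.C]
    exact (map_ne_zero_iff _ (MvPolynomial.C_injective _ _)).mpr h2
  have e1' := (mul_eq_zero.mp e1).resolve_left h2'
  set M := MvPolynomial.map (σ := Fin m) (algebraMap F K)
  have hM : Function.Injective M := MvPolynomial.map_injective _ (algebraMap F K).injective
  have hMd : M ∘ MvPolynomial.C ∘ d = MvPolynomial.C ∘ algebraMap F K ∘ d := by
    funext j; simp [M]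
  have f0 := congrArg M (sub_eq_zero.mp e0)
  have f1 := congrArg M e1'
  rw [map_mul, map_diag, map_diag, hMd] at f0
  rw [map_diag, hMd, map_zero] at f1
  obtain ⟨u', t', hut', g0, g1⟩ := exists_specialization (algebraMap F K ∘ d) _ _ _
    (fun h => hut ⟨funext fun j => hM (by simpa using congrFun h.1 j),
      funext fun j => hM (by simpa using congrFun h.2 j)⟩) f0 f1 (Fin.tail w)
  have ht : diag (algebraMap F K ∘ d) t' t' ≠ 0 := fun h => by
    rw [h, mul_zero] at g0
    exact hut' ⟨hK _ g0, hK _ h⟩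
  have hval : (algebraMap F K (c 0))⁻¹ * diag (algebraMap F K ∘ c) w w =
      w 0 ^ 2 + MvPolynomial.eval (Fin.tail w) (M δ) := by
    have : MvPolynomial.eval (Fin.tail w) (M δ) = (algebraMap F K (c 0))⁻¹ *
        diag (algebraMap F K ∘ Fin.tail c) (Fin.tail w) (Fin.tail w) := by
      simp [hδ, M, diag]
    have hc' : algebraMap F K (c 0) ≠ 0 := (_root_.map_ne_zero _).mpr hc
    rw [this]
    simp only [diag, Fin.sum_univ_succ, Function.comp_apply, Fin.tail]
    field_simp
  -- After specialization `d(w₀ t' + u') = (w₀² + δ(w)) d(t')`. Multiplying by the value `d(t')` and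
  -- dividing by its square gives the desired value.
  obtain ⟨z, hz⟩ := hmul (w 0 • t' + u') t'
  refine ⟨(diag (algebraMap F K ∘ d) t' t')⁻¹ • z, ?_⟩
  rw [diag_smul_left, diag_smul_right, hz, hval, diag_add_left, diag_add_right, diag_add_right]
  simp only [diag_smul_left, diag_smul_right]
  rw [diag_comm _ t' u', g1, g0]
  field_simp
  ring

end Specialization

end PfisterLevel

namespace PfisterLevel

/-! ### Round forms and their doublings -/

section Round

variable {K I J : Type*} [Field K] [Fintype I] [Fintype J]

/-- Every nonzero value of the diagonal form `d` is the factor of a similarity of `d`. -/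
def DiagRound (d : J → K) : Prop :=
  ∀ x, diag d x x ≠ 0 → ∃ σ : (J → K) →ₗ[K] (J → K),
    ∀ y, diag d (σ y) (σ y) = diag d x x * diag d y y

theorem DiagRound.exists_mul {d : J → K} (hd : DiagRound d) (x y : J → K) :
    ∃ z, diag d z z = diag d x x * diag d y y := by
  by_cases hx : diag d x x = 0
  · exact ⟨0, by simp [hx]⟩
  · obtain ⟨σ, hσ⟩ := hd x hx
    exact ⟨σ y, hσ y⟩

theorem diag_sumElim (d : I → K) (e : J → K) (x y : I ⊕ J → K) :
    diag (Sum.elim d e) x y =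
      diag d (x ∘ Sum.inl) (y ∘ Sum.inl) + diag e (x ∘ Sum.inr) (y ∘ Sum.inr) := by
  simp [diag]

theorem diag_smul_coeff (a : K) (d x y : J → K) : diag (a • d) x y = a * diag d x y := by
  simp [diag, Finset.mul_sum, mul_assoc]

theorem diag_comp_equiv (e : I ≃ J) (d x y : J → K) : diag (d ∘ e) (x ∘ e) (y ∘ e) = diag d x y :=
  e.sum_comp fun j => d j * x j * y j

theorem DiagRound.comp_equiv {d : J → K} (hd : DiagRound d) (e : I ≃ J) : DiagRound (d ∘ e) := by
  have key : ∀ x : I → K, diag (d ∘ e) x x = diag d (x ∘ e.symm) (x ∘ e.symm) := fun x => by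
    rw [← diag_comp_equiv e]
    simp [Function.comp_assoc]
  intro x hx
  rw [key] at hx
  obtain ⟨σ, hσ⟩ := hd _ hx
  refine ⟨LinearMap.funLeft K K e ∘ₗ σ ∘ₗ LinearMap.funLeft K K e.symm, fun y => ?_⟩
  rw [key x, key y, ← hσ]
  exact diag_comp_equiv e d _ _

theorem exists_linearMap_sumElim {J : Type*} (f g : (J ⊕ J → K) →ₗ[K] (J → K)) :
    ∃ σ : (J ⊕ J → K) →ₗ[K] (J ⊕ J → K), ∀ y, σ y = Sum.elim (f y) (g y) :=
  ⟨(LinearEquiv.sumArrowLequivProdArrow J J K K).symm.toLinearMap ∘ₗ f.prod g, fun y => by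
    funext i
    cases i <;> rfl⟩

/-- The doubling `d ⊥ a d` of a round form `d` is round. -/
theorem DiagRound.double {d : J → K} (hd : DiagRound d) (a : K) :
    DiagRound (Sum.elim d (a • d)) := by
  intro x hx
  set L : (J ⊕ J → K) →ₗ[K] (J → K) := LinearMap.funLeft K K Sum.inl
  set R : (J ⊕ J → K) →ₗ[K] (J → K) := LinearMap.funLeft K K Sum.inr
  have hL : ∀ y, y ∘ Sum.inl = L y := fun _ => rfl
  have hR : ∀ y, y ∘ Sum.inr = R y := fun _ => rfl
  simp only [diag_sumElim, diag_smul_coeff, hL, hR] at hx ⊢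
  suffices h : ∃ f g : (J ⊕ J → K) →ₗ[K] (J → K), ∀ y,
      diag d (f y) (f y) + a * diag d (g y) (g y) =
        (diag d (L x) (L x) + a * diag d (R x) (R x)) *
          (diag d (L y) (L y) + a * diag d (R y) (R y)) by
    obtain ⟨f, g, hfg⟩ := h
    obtain ⟨σ, hσ⟩ := exists_linearMap_sumElim f g
    refine ⟨σ, fun y => ?_⟩
    have h1 : L (σ y) = f y := by rw [hσ]; rfl
    have h2 : R (σ y) = g y := by rw [hσ]; rfl
    rw [h1, h2, hfg]
  set s := diag d (L x) (L x) with hs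
  set t := diag d (R x) (R x) with ht
  by_cases hs0 : s = 0
  · have ht0 : t ≠ 0 := by rintro h; simp [hs0, h] at hx
    obtain ⟨T, hT⟩ := hd _ ht0
    refine ⟨a • (T ∘ₗ R), T ∘ₗ L, fun y => ?_⟩
    simp only [LinearMap.smul_apply, LinearMap.comp_apply, diag_smul_left, diag_smul_right, hT, hs0]
    simp only [← ht]
    ring
  obtain ⟨S, hS⟩ := hd _ hs0
  by_cases ht0 : t = 0
  · refine ⟨S ∘ₗ L, S ∘ₗ R, fun y => ?_⟩
    simp only [LinearMap.comp_apply, hS, ht0]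
    simp only [← hs]
    ring
  obtain ⟨T, hT⟩ := hd _ ht0
  -- `Z` carries the second component to the first space with similarity factor `(s t)⁻¹`. The
  -- coefficients `-a t` and `s` below make the cross terms `∓2 a s t d(L y, Z y)` cancel.
  set Z : (J ⊕ J → K) →ₗ[K] (J → K) := (s * t)⁻¹ • (S ∘ₗ T ∘ₗ R)
  refine ⟨S ∘ₗ (L - (a * t) • Z), T ∘ₗ (L + s • Z), fun y => ?_⟩
  have hZ : diag d (Z y) (Z y) = (s * t)⁻¹ * diag d (R y) (R y) := by
    simp only [Z, LinearMap.smul_apply, LinearMap.comp_apply, diag_smul_left, diag_smul_right,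
      hS, hT]
    simp only [← hs, ← ht]
    field_simp
  simp only [LinearMap.comp_apply, hS, hT, LinearMap.sub_apply, LinearMap.add_apply,
    LinearMap.smul_apply, diag_sub_left, diag_sub_right, diag_add_left, diag_add_right,
    diag_smul_left, diag_smul_right, hZ, diag_comm d (Z y) (L y)]
  simp only [← hs, ← ht]
  field_simp
  ring

end Round

/-! ### Diagonal coefficients of Pfister forms -/

section Pfister

variable {F : Type*} [Field F]

/-- The index type of the diagonal form of `⟨1, a₁⟩ ⊗ ⋯ ⊗ ⟨1, aₙ⟩`. -/
def PfisterIndex : List Fˣ → Type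
  | [] => Unit
  | _ :: l => PfisterIndex l ⊕ PfisterIndex l

instance PfisterIndex.instFintype : (l : List Fˣ) → Fintype (PfisterIndex l)
  | [] => inferInstanceAs (Fintype Unit)
  | _ :: l =>
    let _ := PfisterIndex.instFintype l
    inferInstanceAs (Fintype (PfisterIndex l ⊕ PfisterIndex l))

/-- The coefficients of the diagonal form of `⟨1, a₁⟩ ⊗ ⋯ ⊗ ⟨1, aₙ⟩`. -/
def pfisterCoeff : (l : List Fˣ) → PfisterIndex l → F
  | [] => fun _ => 1
  | a :: l => Sum.elim (pfisterCoeff l) ((a : F) • pfisterCoeff l)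

/-- Each Pfister slot is a doubling, so roundness follows by induction from `⟨1⟩`. An arbitrary `f`
is allowed because roundness is needed over `F`, over the function field and over all auxiliary
extensions. -/
theorem diagRound_pfisterCoeff {K : Type*} [Field K] (f : F →+* K) (l : List Fˣ) :
    DiagRound (f ∘ pfisterCoeff l) := by
  induction l with
  | nil =>
    intro x _
    refine ⟨x () • LinearMap.id, fun y => ?_⟩
    rw [LinearMap.smul_apply, LinearMap.id_apply, diag_smul_left, diag_smul_right, ← mul_assoc]
    congr 1
    change x () * x () = ∑ j : Unit, f 1 * x j * x j
    simp
  | cons a l ih =>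
    have h := ih.double (f a)
    have hc : Sum.elim (f ∘ pfisterCoeff l) (f a • (f ∘ pfisterCoeff l)) =
        f ∘ Sum.elim (pfisterCoeff l) ((a : F) • pfisterCoeff l) := by
      funext i
      cases i <;> simp
    rw [hc] at h
    exact h

theorem pfisterCoeff_represents_one (l : List Fˣ) :
    ∃ x, diag (pfisterCoeff l) x x = 1 := by
  induction l with
  | nil => exact ⟨fun _ => 1, by change ∑ j : Unit, _ = _; simp [pfisterCoeff]⟩
  | cons a l ih =>
    obtain ⟨x, hx⟩ := ih
    refine ⟨Sum.elim x 0, ?_⟩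
    refine (diag_sumElim (pfisterCoeff l) ((a : F) • pfisterCoeff l) _ _).trans ?_
    simp [hx]

end Pfister

/-! ### Orthogonal bases of quadratic forms -/

section DiagonalBasis

variable {K V W I J : Type*} [Field K] [Invertible (2 : K)] [AddCommGroup V] [Module K V]
  [AddCommGroup W] [Module K W]

/-- `v` is an orthogonal basis for `Q`, on which `Q` has the values `d`. -/
def IsDiagonal (Q : QuadraticForm K V) (v : Module.Basis J K V) (d : J → K) : Prop :=
  (∀ j, Q (v j) = d j) ∧ ∀ i j, i ≠ j → QuadraticMap.associated Q (v i) (v j) = 0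

theorem IsDiagonal.associated_sum [Fintype J] {Q : QuadraticForm K V} {v : Module.Basis J K V} {d : J → K}
    (h : IsDiagonal Q v d) (x y : J → K) :
    QuadraticMap.associated Q (∑ j, x j • v j) (∑ j, y j • v j) = diag d x y := by
  simp only [map_sum, LinearMap.sum_apply, map_smul, LinearMap.smul_apply, diag]
  refine Finset.sum_congr rfl fun j _ => ?_
  rw [Finset.sum_eq_single j (fun i _ hij => by rw [h.2 i j hij]; simp) (by simp),
    QuadraticMap.associated_eq_self_apply, h.1]
  simp only [smul_eq_mul]
  ring

theorem IsDiagonal.apply_sum [Fintype J] {Q : QuadraticForm K V} {v : Module.Basis J K V} {d : J → K}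
    (h : IsDiagonal Q v d) (x : J → K) : Q (∑ j, x j • v j) = diag d x x := by
  rw [← h.associated_sum, QuadraticMap.associated_eq_self_apply]

theorem IsDiagonal.apply [Fintype J] {Q : QuadraticForm K V} {v : Module.Basis J K V} {d : J → K}
    (h : IsDiagonal Q v d) (x : V) : Q x = diag d (v.equivFun x) (v.equivFun x) := by
  rw [← h.apply_sum, v.sum_equivFun]

theorem IsDiagonal.map {Q : QuadraticForm K V} {v : Module.Basis J K V} {d : J → K}
    (h : IsDiagonal Q v d) {Q' : QuadraticForm K W} (e : Q.IsometryEquiv Q') :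
    IsDiagonal Q' (v.map e.toLinearEquiv) d := by
  have he : ∀ x, Q' (e.toLinearEquiv x) = Q x := e.map_app
  refine ⟨fun j => ?_, fun i j hij => ?_⟩
  · rw [Module.Basis.map_apply, he, h.1]
  · rw [← h.2 i j hij]
    simp only [Module.Basis.map_apply, QuadraticMap.associated_apply, ← map_add, he]

theorem IsDiagonal.reindex {Q : QuadraticForm K V} {v : Module.Basis J K V} {d : J → K}
    (h : IsDiagonal Q v d) (e : J ≃ I) : IsDiagonal Q (v.reindex e) (d ∘ e.symm) :=
  ⟨fun i => by simp [h.1], fun i j hij => by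
    rw [Module.Basis.reindex_apply, Module.Basis.reindex_apply]
    exact h.2 _ _ (e.symm.injective.ne hij)⟩

theorem IsDiagonal.tmul {Q : QuadraticForm K V} {v : Module.Basis I K V} {d : I → K}
    (h : IsDiagonal Q v d) {Q' : QuadraticForm K W} {v' : Module.Basis J K W} {d' : J → K}
    (h' : IsDiagonal Q' v' d') :
    IsDiagonal (Q.tmul Q') (v.tensorProduct v') fun p => d' p.2 * d p.1 := by
  refine ⟨fun p => ?_, fun p p' hp => ?_⟩
  · rw [Module.Basis.tensorProduct_apply', QuadraticForm.tensorDistrib_tmul, h.1, h'.1,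
      smul_eq_mul]
  · rw [QuadraticForm.associated_tmul, Module.Basis.tensorProduct_apply',
      Module.Basis.tensorProduct_apply', LinearMap.BilinForm.tensorDistrib_tmul]
    by_cases h1 : p.1 = p'.1
    · rw [h'.2 _ _ fun h2 => hp (Prod.ext h1 h2), zero_smul]
    · rw [h.2 _ _ h1, smul_zero]

theorem IsDiagonal.baseChange {A : Type*} [Field A] [Algebra K A] [Invertible (2 : A)]
    {Q : QuadraticForm K V} {v : Module.Basis J K V} {d : J → K} (h : IsDiagonal Q v d) :
    IsDiagonal (Q.baseChange A) (v.baseChange A) (algebraMap K A ∘ d) := by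
  refine ⟨fun j => ?_, fun i j hij => ?_⟩
  · rw [Module.Basis.baseChange_apply, QuadraticForm.baseChange_tmul, h.1, mul_one,
      Algebra.smul_def, mul_one, Function.comp_apply]
  · rw [QuadraticForm.associated_baseChange, Module.Basis.baseChange_apply,
      Module.Basis.baseChange_apply, LinearMap.BilinForm.baseChange_tmul, h.2 i j hij]
    simp

theorem IsDiagonal.copies {Q : QuadraticForm K V} {v : Module.Basis J K V} {d : J → K}
    (h : IsDiagonal Q v d) [Finite J] (n : ℕ) :
    IsDiagonal (PfisterLevel.copies n Q)
      ((Pi.basis fun _ : Fin n => v).reindex (Equiv.sigmaEquivProd (Fin n) J))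
      (d ∘ Prod.snd) := by
  refine ⟨fun p => ?_, fun p p' hp => ?_⟩
  · rw [Module.Basis.reindex_apply, Equiv.sigmaEquivProd_symm_apply, Pi.basis_apply,
      PfisterLevel.copies, QuadraticMap.pi_apply_single, h.1, Function.comp_apply]
  · rw [PfisterLevel.copies, QuadraticMap.Ring.associated_pi]
    simp only [Module.Basis.reindex_apply, Pi.basis_apply, Equiv.sigmaEquivProd_symm_apply]
    simp only [LinearMap.sum_apply, LinearMap.compl₁₂_apply, LinearMap.proj_apply]
    refine Finset.sum_eq_zero fun i _ => ?_
    by_cases h1 : p.1 = i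
    · by_cases h2 : p'.1 = i
      · rw [h1, h2, Pi.single_eq_same, Pi.single_eq_same]
        exact h.2 _ _ fun h3 => hp (Prod.ext (h1.trans h2.symm) h3)
      · rw [Pi.single_eq_of_ne (Ne.symm h2), map_zero]
    · rw [Pi.single_eq_of_ne (Ne.symm h1), map_zero, LinearMap.zero_apply]

theorem isDiagonal_binary (a b : K) : IsDiagonal (binary a b) (Pi.basisFun K (Fin 2)) ![a, b] := by
  refine ⟨fun j => ?_, fun i j hij => ?_⟩
  · simp [binary, Pi.single_apply]
  · rw [QuadraticMap.associated_apply]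
    fin_cases i <;> fin_cases j <;> simp_all [binary, Pi.single_apply]

theorem exists_isDiagonal_pfisterForm (l : List Kˣ) :
    ∃ v : Module.Basis (PfisterIndex l) K (pfisterForm l),
      IsDiagonal (pfisterForm l).form v (pfisterCoeff l) := by
  induction l with
  | nil =>
    refine ⟨(Module.Basis.singleton Unit K : Module.Basis Unit K K), fun j => ?_,
      fun i j hij => (hij (Subsingleton.elim (α := Unit) i j)).elim⟩
    have h : QuadraticMap.sq (R := K) (Module.Basis.singleton Unit K ()) = 1 := by
      rw [QuadraticMap.sq_apply, Module.Basis.singleton_apply, mul_one]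
    exact h
  | cons a l ih =>
    obtain ⟨v, hv⟩ := ih
    let e : Fin 2 × PfisterIndex l ≃ PfisterIndex l ⊕ PfisterIndex l :=
      (Equiv.prodCongrLeft fun _ => finTwoEquiv).trans (Equiv.boolProdEquivSum _)
    refine ⟨(((Pi.basisFun K (Fin 2)).tensorProduct v).reindex e), ?_⟩
    have h := ((isDiagonal_binary 1 (a : K)).tmul hv).reindex e
    have hc : (fun p : Fin 2 × PfisterIndex l => pfisterCoeff l p.2 * ![1, (a : K)] p.1) ∘ e.symm =
        Sum.elim (pfisterCoeff l) ((a : K) • pfisterCoeff l) := by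
      funext i
      cases i <;> simp [e, finTwoEquiv, mul_comm]
    rw [hc] at h
    exact h

theorem IsPfister.exists_isDiagonal {q : QuadraticForm K V} (hq : IsPfister q) :
    ∃ (l : List Kˣ) (v : Module.Basis (PfisterIndex l) K V), IsDiagonal q v (pfisterCoeff l) := by
  obtain ⟨l, ⟨e⟩⟩ := hq
  obtain ⟨v, hv⟩ := exists_isDiagonal_pfisterForm l
  exact ⟨l, _, hv.map e.symm⟩

end DiagonalBasis

/-! ### Isotropy, representation of -1 and hyperbolicity of multiples -/

section Doubling

variable {K I J : Type*} [Field K] [Fintype I] [Fintype J]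

theorem diag_single_right [DecidableEq J] (d x : J → K) (j : J) (b : K) :
    diag d x (Pi.single j b) = d j * x j * b := by
  simp [diag, Pi.single_apply]

/-- An isotropic regular diagonal form is universal. -/
theorem exists_diag_eq_of_not_anisotropic (h2 : (2 : K) ≠ 0) {d : J → K} (hd0 : ∀ j, d j ≠ 0)
    (hd : ¬DiagAnisotropic d) (b : K) : ∃ x, diag d x x = b := by
  classical
  simp only [DiagAnisotropic, not_forall] at hd
  obtain ⟨x, hx, hx0⟩ := hd
  obtain ⟨j, hj⟩ := Function.ne_iff.mp hx0
  rw [Pi.zero_apply] at hj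
  -- On `λ x + e_j` the form has value `2 λ d_j x_j + d_j`, which is linear in `λ`.
  refine ⟨((b - d j) / (2 * (d j * x j))) • x + Pi.single j 1, ?_⟩
  rw [diag_add_left, diag_add_right, diag_add_right, diag_comm d (Pi.single j 1) (_ • x)]
  simp only [diag_smul_left, diag_smul_right, hx, diag_single_right, Pi.single_eq_same, Pi.smul_apply,
    smul_eq_mul]
  have := hd0 j
  field_simp
  ring

/-- If `d ⊥ d` is isotropic and `d` is round, then `d` represents `-1`. -/
theorem DiagRound.exists_diag_eq_neg_one (h2 : (2 : K) ≠ 0) {d : J → K} (hd0 : ∀ j, d j ≠ 0)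
    (hd : DiagRound d) (h : ¬DiagAnisotropic (Sum.elim d d)) : ∃ x, diag d x x = -1 := by
  by_cases hd' : DiagAnisotropic d
  · simp only [DiagAnisotropic, not_forall] at h
    obtain ⟨y, hy, hy0⟩ := h
    rw [diag_sumElim] at hy
    set u := y ∘ Sum.inl with hu
    set w := y ∘ Sum.inr with hw
    have hs : diag d u u ≠ 0 := fun hs => hy0 (by
      rw [hs, zero_add] at hy
      have h1 := hd' _ hs
      have h2 := hd' _ hy
      funext i
      rcases i with i | i
      · exact congrFun h1 i
      · exact congrFun h2 i)
    -- Since `d(w) = -d(u)`, the product `d(u) d(w)` is `-d(u)²`, so dividing by `d(u)²` gives `-1`.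
    obtain ⟨z, hz⟩ := hd.exists_mul u w
    refine ⟨(diag d u u)⁻¹ • z, ?_⟩
    rw [diag_smul_left, diag_smul_right, hz, eq_neg_of_add_eq_zero_right hy]
    field_simp
  · exact exists_diag_eq_of_not_anisotropic h2 hd0 hd' _

/-- `Fin (n + k) × J` is the disjoint union of `Fin n × J` and `Fin k × J`. -/
def finAddProdEquiv (n k : ℕ) (J : Type*) : Fin (n + k) × J ≃ (Fin n × J) ⊕ (Fin k × J) :=
  (finSumFinEquiv.symm.prodCongr (Equiv.refl J)).trans (Equiv.sumProdDistrib _ _ _)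

theorem sumElim_comp_finAddProdEquiv {α J : Type*} (n k : ℕ) (d : J → α) :
    Sum.elim (d ∘ Prod.snd) (d ∘ Prod.snd) ∘ finAddProdEquiv n k J = d ∘ Prod.snd := by
  funext p
  obtain ⟨i, j⟩ := p
  refine Fin.addCases (fun i => ?_) (fun i => ?_) i <;> simp [finAddProdEquiv]

theorem diag_copies_add (n k : ℕ) (d : J → K) (x y : (Fin n × J) ⊕ (Fin k × J) → K) :
    diag (d ∘ Prod.snd) (x ∘ finAddProdEquiv n k J) (y ∘ finAddProdEquiv n k J) =
      diag (Sum.elim (d ∘ Prod.snd) (d ∘ Prod.snd)) x y := by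
  rw [← sumElim_comp_finAddProdEquiv, diag_comp_equiv]

theorem diagAnisotropic_comp_equiv (e : I ≃ J) {d : J → K} :
    DiagAnisotropic (d ∘ e) ↔ DiagAnisotropic d := by
  refine ⟨fun h x hx => ?_, fun h x hx => ?_⟩
  · have := h (x ∘ e) (by rwa [diag_comp_equiv])
    funext j
    simpa using congrFun this (e.symm j)
  · have := h (x ∘ e.symm) (by
      rw [← diag_comp_equiv e, Function.comp_assoc, e.symm_comp_self]; exact hx)
    funext j
    simpa using congrFun this (e j)

theorem diagAnisotropic_copies_add (n k : ℕ) (d : J → K) :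
    DiagAnisotropic (Sum.elim (d ∘ Prod.snd (α := Fin n)) (d ∘ Prod.snd (α := Fin k))) ↔
      DiagAnisotropic (d ∘ Prod.snd (α := Fin (n + k))) := by
  rw [← sumElim_comp_finAddProdEquiv, diagAnisotropic_comp_equiv]

theorem DiagAnisotropic.of_copies_le {n m : ℕ} (hnm : n ≤ m) {d : J → K}
    (h : DiagAnisotropic (d ∘ Prod.snd (α := Fin m))) :
    DiagAnisotropic (d ∘ Prod.snd (α := Fin n)) := by
  obtain ⟨k, rfl⟩ := Nat.exists_eq_add_of_le hnm
  intro x hx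
  have := (diagAnisotropic_copies_add n k d).mpr h (Sum.elim x 0) (by
    rw [diag_sumElim]; simpa using hx)
  funext i
  exact congrFun this (Sum.inl i)

/-- `2^(r+1) × d` is the doubling of `2^r × d` with factor `1`. -/
theorem DiagRound.copies {d : J → K} (hd : DiagRound d) (r : ℕ) :
    DiagRound (d ∘ Prod.snd (α := Fin (2 ^ r))) := by
  induction r with
  | zero => exact hd.comp_equiv (Equiv.uniqueProd J (Fin 1))
  | succ r ih =>
    have h := (ih.double 1).comp_equiv (finAddProdEquiv (2 ^ r) (2 ^ r) J)
    rw [one_smul, sumElim_comp_finAddProdEquiv] at h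
    rw [Nat.two_pow_succ]
    exact h

theorem DiagRound.exists_diag_copies_eq_neg_one (h2 : (2 : K) ≠ 0) {d : J → K}
    (hd0 : ∀ j, d j ≠ 0) (hd : DiagRound d) (r : ℕ)
    (h : ¬DiagAnisotropic (d ∘ Prod.snd (α := Fin (2 ^ (r + 1))))) :
    ∃ x, diag (d ∘ Prod.snd (α := Fin (2 ^ r))) x x = -1 := by
  refine (hd.copies r).exists_diag_eq_neg_one h2 (fun p => hd0 p.2) ?_
  rwa [diagAnisotropic_copies_add, ← Nat.two_pow_succ]

theorem not_diagAnisotropic_copies_succ {d : J → K} {n : ℕ} {x : Fin n × J → K} {x₁ : J → K}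
    (hx : diag (d ∘ Prod.snd) x x = -1) (hx₁ : diag d x₁ x₁ = 1) :
    ¬DiagAnisotropic (d ∘ Prod.snd (α := Fin (n + 1))) := by
  rw [← diagAnisotropic_copies_add]
  intro h
  have := h (Sum.elim x (x₁ ∘ Prod.snd)) (by
    have h1 : diag (d ∘ Prod.snd (α := Fin 1)) (x₁ ∘ Prod.snd) (x₁ ∘ Prod.snd) = 1 := by
      rw [← hx₁]
      exact diag_comp_equiv (Equiv.uniqueProd J (Fin 1)) d x₁ x₁
    rw [diag_sumElim, Sum.elim_comp_inl, Sum.elim_comp_inr, hx, h1, neg_add_cancel])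
  have hx0 : x = 0 := funext fun i => congrFun this (Sum.inl i)
  rw [hx0, diag_zero_left] at hx
  exact one_ne_zero (neg_eq_zero.mp hx.symm)

/-- If a round form `d` represents `-1`, then `d ⊥ d` is hyperbolic: it contains every diagonal form
of dimension at most `dim d`. -/
theorem DiagRound.exists_orthogonal_of_neg_one (h2 : (2 : K) ≠ 0) {d : J → K}
    (hd0 : ∀ j, d j ≠ 0) (hd : DiagRound d) {x : J → K} (hx : diag d x x = -1) {m : ℕ}
    (hm : m ≤ Fintype.card J) (c : Fin m → K) :
    ∃ g : Fin m → J ⊕ J → K, (∀ i, diag (Sum.elim d d) (g i) (g i) = c i) ∧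
      ∀ i j, i ≠ j → diag (Sum.elim d d) (g i) (g j) = 0 := by
  classical
  obtain ⟨σ, hσ⟩ := hd x (by rw [hx]; exact neg_ne_zero.mpr one_ne_zero)
  have hσ' : ∀ y z, diag d (σ y) (σ z) = -diag d y z := fun y z => by
    have h := hσ (y + z)
    rw [map_add, diag_add_left, diag_add_right, diag_add_right, hσ, hσ, hx,
      diag_comm d (σ z) (σ y), diag_add_left, diag_add_right, diag_add_right,
      diag_comm d z y] at h
    exact mul_left_cancel₀ h2 (by linear_combination h)
  obtain ⟨f⟩ : Nonempty (Fin m ↪ J) :=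
    Function.Embedding.nonempty_of_card_le (by rwa [Fintype.card_fin])
  have h4 : (4 : K) ≠ 0 := by
    have : (4 : K) = 2 * 2 := by norm_num
    rw [this]; exact mul_ne_zero h2 h2
  -- For a basis vector `e`, the vector `(α e, β σ e)` has value `(α² - β²) d(e)`, because `σ` has
  -- factor `-1`. With `α, β = 1 ± c/(4 d(e))` this is `c`.
  refine ⟨fun i => Sum.elim ((1 + c i / (4 * d (f i))) • Pi.single (f i) 1)
    ((1 - c i / (4 * d (f i))) • σ (Pi.single (f i) 1)), fun i => ?_, fun i j hij => ?_⟩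
  · rw [diag_sumElim]
    simp only [Sum.elim_comp_inl, Sum.elim_comp_inr, diag_smul_left, diag_smul_right, hσ',
      diag_single_right, Pi.single_eq_same, Pi.smul_apply, smul_eq_mul]
    have := hd0 (f i)
    field_simp
    ring
  · rw [diag_sumElim]
    simp only [Sum.elim_comp_inl, Sum.elim_comp_inr, diag_smul_left, diag_smul_right, hσ',
      diag_single_right, Pi.single_eq_of_ne (f.injective.ne hij.symm),
      Pi.smul_apply, smul_eq_mul]
    ring

end Doubling

/-! ### Subforms and isometric embeddings -/

section Subform

variable {K V W : Type*} [Field K] [Invertible (2 : K)] [AddCommGroup V] [Module K V]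
  [AddCommGroup W] [Module K W]

theorem IsDiagonal.nondegenerate {J : Type*} [Fintype J] {Q : QuadraticForm K V}
    {v : Module.Basis J K V} {d : J → K} (h : IsDiagonal Q v d) (hd0 : ∀ j, d j ≠ 0) :
    Q.Nondegenerate := by
  classical
  rw [QuadraticMap.nondegenerate_iff_radical_eq_bot, QuadraticMap.radical_eq_ker_associated,
    eq_bot_iff]
  intro x hx
  rw [LinearMap.mem_ker] at hx
  rw [Submodule.mem_bot, ← v.sum_equivFun x]
  refine Finset.sum_eq_zero fun j _ => ?_
  have h1 := h.associated_sum (v.equivFun x) (Pi.single j 1)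
  rw [v.sum_equivFun, hx, diag_single_right, mul_one, LinearMap.zero_apply] at h1
  rw [(mul_eq_zero.mp h1.symm).resolve_left (hd0 j), zero_smul]

/-- The image of an isometric embedding of an anisotropic form is a subform. -/
theorem isSubform_of_isometry [FiniteDimensional K V] {p : QuadraticForm K W}
    {Q : QuadraticForm K V} (hp : p.Anisotropic) (hQ : Q.Nondegenerate) (f : W →ₗ[K] V)
    (hf : ∀ w, Q (f w) = p w) : IsSubform p Q := by
  set B := QuadraticMap.associated Q with hB
  have hBs : ∀ x y, B x y = B y x := fun x y => QuadraticMap.associated_isSymm K Q x y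
  have hinj : Function.Injective f := by
    rw [injective_iff_map_eq_zero]
    intro w hw
    exact hp w (by rw [← hf, hw, QuadraticMap.map_zero])
  have hBrefl : LinearMap.IsRefl B := fun x y h => by rw [hBs, h]
  -- Anisotropy of `p` makes the image meet its orthogonal complement trivially, so it splits off.
  have hcompl : IsCompl (LinearMap.range f) (LinearMap.BilinForm.orthogonal B (LinearMap.range f)) := by
    rw [LinearMap.BilinForm.isCompl_orthogonal_iff_disjoint hBrefl, Submodule.disjoint_def]
    rintro _ ⟨w, rfl⟩ hw
    have h0 : B (f w) (f w) = 0 := hw (f w) ⟨w, rfl⟩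
    rw [hB, QuadraticMap.associated_eq_self_apply, hf] at h0
    rw [hp w h0, map_zero]
  set U := LinearMap.BilinForm.orthogonal B (LinearMap.range f)
  let e := Module.finBasis K U
  let r : QuadraticForm K (Fin (Module.finrank K U) → K) :=
    Q.comp (U.subtype ∘ₗ e.equivFun.symm.toLinearMap)
  let E : (W × (Fin (Module.finrank K U) → K)) ≃ₗ[K] V :=
    ((LinearEquiv.ofInjective f hinj).prodCongr e.equivFun.symm).trans
      (Submodule.prodEquivOfIsCompl _ _ hcompl)
  have hE : ∀ x, Q (E x) = p.prod r x := by
    rintro ⟨w, y⟩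
    have h1 : E (w, y) = f w + (e.equivFun.symm y : V) := by
      simp [E, Submodule.coe_prodEquivOfIsCompl']
    have h2 : B (f w) (e.equivFun.symm y : V) = 0 := (e.equivFun.symm y).2 (f w) ⟨w, rfl⟩
    have h3 : Q.IsOrtho (f w) (e.equivFun.symm y : V) := QuadraticMap.associated_isOrtho.mp h2
    rw [h1, QuadraticMap.isOrtho_def.mp h3, hf, QuadraticMap.prod_apply]
    rfl
  refine ⟨_, r, ?_, ⟨QuadraticMap.IsometryEquiv.symm ⟨E, hE⟩⟩⟩
  rw [QuadraticMap.nondegenerate_iff_radical_eq_bot, eq_bot_iff] at hQ ⊢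
  intro y hy
  rw [QuadraticMap.mem_radical_iff'] at hy
  -- A radical vector of the complement is radical in the whole nondegenerate space.
  have hy' : E (0, y) ∈ Q.radical := by
    rw [QuadraticMap.mem_radical_iff']
    refine ⟨by rw [hE, QuadraticMap.prod_apply, hy.1, QuadraticMap.map_zero, add_zero], fun z => ?_⟩
    obtain ⟨⟨w, y'⟩, rfl⟩ := E.surjective z
    rw [← map_add, hE, hE, QuadraticMap.prod_apply, QuadraticMap.prod_apply, Prod.fst_add,
      Prod.snd_add, hy.2, zero_add]
  have h0 := hQ hy'
  rw [Submodule.mem_bot, LinearEquiv.map_eq_zero_iff] at h0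
  exact (Prod.ext_iff.mp h0).2

theorem isSubform_of_orthogonal [FiniteDimensional K V] {I J : Type*} [Fintype I] [Fintype J]
    {p : QuadraticForm K W} {Q : QuadraticForm K V} {e : Module.Basis I K W} {c : I → K}
    (hpe : IsDiagonal p e c) (hp : p.Anisotropic) {v : Module.Basis J K V} {d : J → K}
    (hQ : IsDiagonal Q v d) (hd0 : ∀ j, d j ≠ 0) (g : I → J → K)
    (hg : ∀ i, diag d (g i) (g i) = c i) (hgo : ∀ i j, i ≠ j → diag d (g i) (g j) = 0) :
    IsSubform p Q := by
  refine isSubform_of_isometry hp (hQ.nondegenerate hd0)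
    (e.constr K fun i => v.equivFun.symm (g i)) fun w => ?_
  rw [hQ.apply, hpe.apply, Module.Basis.constr_apply_fintype]
  simp only [map_sum, map_smul, LinearEquiv.apply_symm_apply, diag_sum_left, diag_sum_right,
    diag_smul_left, diag_smul_right]
  refine Finset.sum_congr rfl fun i _ => ?_
  rw [Finset.sum_eq_single i (fun j _ hij => by rw [hgo j i hij]; ring) (by simp), hg]
  ring

theorem IsSubform.exists_orthogonal {I J : Type*} [Fintype J]
    {p : QuadraticForm K W} {Q : QuadraticForm K V} (h : IsSubform p Q) {e : Module.Basis I K W}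
    {c : I → K} (hp : IsDiagonal p e c) {v : Module.Basis J K V} {d : J → K}
    (hQ : IsDiagonal Q v d) :
    ∃ g : I → J → K, (∀ i, diag d (g i) (g i) = c i) ∧
      ∀ i j, i ≠ j → diag d (g i) (g j) = 0 := by
  obtain ⟨m, r, -, ⟨E⟩⟩ := h
  set f : W →ₗ[K] V := E.symm.toLinearEquiv.toLinearMap ∘ₗ LinearMap.inl K W (Fin m → K)
  have hf : ∀ w, Q (f w) = p w := fun w => by
    have : Q (E.symm (w, 0)) = p.prod r (w, 0) := E.symm.map_app _
    rw [QuadraticMap.prod_apply, QuadraticMap.map_zero, add_zero] at this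
    exact this
  refine ⟨fun i => v.equivFun (f (e i)), fun i => ?_, fun i j hij => ?_⟩
  · rw [← hQ.apply, hf, hp.1]
  · rw [← hQ.associated_sum, v.sum_equivFun, v.sum_equivFun, ← hp.2 i j hij]
    simp only [QuadraticMap.associated_apply, ← map_add, hf]

end Subform

/-! ### Linear substitutions between coordinate systems -/

section CoordinateChange

variable {F W I J : Type*} [Field F] [AddCommGroup W] [Module F W] [Fintype J]

/-- The linear substitution expressing coordinates with respect to `p` in terms of those with
respect to `q`. -/
def coordChange (p : Module.Basis I F W) (q : Module.Basis J F W) :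
    MvPolynomial I F →ₐ[F] MvPolynomial J F :=
  MvPolynomial.aeval fun i => ∑ j, MvPolynomial.C (p.toMatrix q i j) * MvPolynomial.X j

theorem coordChange_X (p : Module.Basis I F W) (q : Module.Basis J F W) (i : I) :
    coordChange p q (MvPolynomial.X i) =
      ∑ j, MvPolynomial.C (p.toMatrix q i j) * MvPolynomial.X j :=
  MvPolynomial.aeval_X _ _

theorem coordChange_coordChange [Fintype I] (p : Module.Basis I F W) (q : Module.Basis J F W)
    (f : MvPolynomial I F) : coordChange q p (coordChange p q f) = f := by
  classical
  suffices h : (coordChange q p).comp (coordChange p q) = AlgHom.id F _ from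
    DFunLike.congr_fun h f
  refine MvPolynomial.algHom_ext fun i => ?_
  rw [AlgHom.comp_apply, coordChange_X, map_sum]
  simp only [map_mul, coordChange_X, MvPolynomial.algHom_C, MvPolynomial.algebraMap_eq,
    Finset.mul_sum]
  rw [Finset.sum_comm]
  simp only [← mul_assoc, ← Finset.sum_mul, ← MvPolynomial.C_mul, ← map_sum, ← Matrix.mul_apply,
    Module.Basis.toMatrix_mul_toMatrix_flip, AlgHom.id_apply]
  rw [Finset.sum_eq_single i (fun j _ hj => by simp [Matrix.one_apply_ne hj.symm]) (by simp),
    Matrix.one_apply_eq, MvPolynomial.C_1, one_mul]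

variable [Fintype I] [Invertible (2 : F)]

/-- The function field is defined through the arbitrary basis `b`, while the arguments need an
orthogonal basis; this identifies the two equations of the quadric. -/
theorem coordChange_diag {φ : QuadraticForm F W} {e : Module.Basis I F W} {c : I → F}
    (he : IsDiagonal φ e c) (b : Module.Basis J F W) :
    coordChange e b (diag (MvPolynomial.C ∘ c) MvPolynomial.X MvPolynomial.X) = toPoly φ b := by
  have key : ∀ i j, ⅟2 * QuadraticMap.polar φ (b i) (b j) =
      ∑ k, c k * e.toMatrix b k i * e.toMatrix b k j := fun i j => by
    have h := he.associated_sum (e.repr (b i)) (e.repr (b j))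
    rw [e.sum_repr, e.sum_repr, QuadraticMap.associated_apply] at h
    rw [← smul_eq_mul]
    refine Eq.trans ?_ h
    simp [QuadraticMap.polar]
  simp only [toPoly, key, diag, map_sum, map_mul, coordChange_X, Function.comp_apply,
    MvPolynomial.algHom_C, MvPolynomial.algebraMap_eq]
  calc _ = ∑ k, ∑ i, ∑ j, MvPolynomial.C (c k) *
        (MvPolynomial.C (e.toMatrix b k i) * MvPolynomial.X i) *
          (MvPolynomial.C (e.toMatrix b k j) * MvPolynomial.X j) :=
        Finset.sum_congr rfl fun k _ => by
          simp only [Finset.mul_sum, Finset.sum_mul]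
          rw [Finset.sum_comm]
    _ = ∑ i, ∑ j, ∑ k, MvPolynomial.C (c k) *
        (MvPolynomial.C (e.toMatrix b k i) * MvPolynomial.X i) *
          (MvPolynomial.C (e.toMatrix b k j) * MvPolynomial.X j) := by
        rw [Finset.sum_comm]
        exact Finset.sum_congr rfl fun i _ => Finset.sum_comm
    _ = _ := Finset.sum_congr rfl fun i _ => Finset.sum_congr rfl fun j _ => by
        simp only [Finset.sum_mul]
        exact Finset.sum_congr rfl fun k _ => by ring

end CoordinateChange

/-! ### Isotropy over the function field -/

section FunctionField

variable {F W ι : Type*} [Field F] [Invertible (2 : F)] [AddCommGroup W] [Module F W] [Fintype ι]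

theorem algebraMap_mk_eq_zero_iff {φ : QuadraticForm F W} {b : Module.Basis ι F W}
    (hI : quadricIdeal φ b = Ideal.span {toPoly φ b}) (p : MvPolynomial ι F) :
    algebraMap (MvPolynomial ι F ⧸ quadricIdeal φ b) (FunctionField φ b)
      (Ideal.Quotient.mk _ p) = 0 ↔ toPoly φ b ∣ p := by
  rw [← Ideal.mem_span_singleton, ← hI, ← Ideal.Quotient.eq_zero_iff_mem]
  exact map_eq_zero_iff _ (IsFractionRing.injective _ _)

/-- The generic point: the classes of the coordinates satisfy the equation, and the first is nonzero
for degree reasons. -/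
theorem exists_zero_functionField {φ : QuadraticForm F W} {b : Module.Basis ι F W}
    (hI : quadricIdeal φ b = Ideal.span {toPoly φ b}) {m : ℕ}
    {e : Module.Basis (Fin (m + 1)) F W} {c : Fin (m + 1) → F} (he : IsDiagonal φ e c)
    (hc : c 0 ≠ 0) :
    ∃ y : Fin (m + 1) → FunctionField φ b, y ≠ 0 ∧
      diag (algebraMap F (FunctionField φ b) ∘ c) y y = 0 := by
  let π := ((algebraMap (MvPolynomial ι F ⧸ quadricIdeal φ b) (FunctionField φ b)).comp
    (Ideal.Quotient.mk _)).comp (coordChange e b).toRingHom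
  have hπ : ∀ p, π p = 0 ↔ toPoly φ b ∣ coordChange e b p := fun p =>
    algebraMap_mk_eq_zero_iff hI _
  have hπC : algebraMap F (FunctionField φ b) ∘ c = π ∘ MvPolynomial.C ∘ c := by
    funext i
    simp only [π, Function.comp_apply, RingHom.comp_apply]
    erw [MvPolynomial.algHom_C]
    rfl
  refine ⟨π ∘ MvPolynomial.X, fun h => ?_, ?_⟩
  · have h0 := (hπ _).mp (congrFun h 0)
    have h1 := map_dvd (coordChange b e) h0
    rw [← coordChange_diag he, coordChange_coordChange, coordChange_coordChange] at h1
    exact not_diag_dvd_X_zero hc h1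
  · rw [hπC, ← map_diag, hπ, coordChange_diag he]

/-- Clear denominators of an isotropic vector, lift it to polynomials and pass to orthogonal
coordinates: vanishing in the function field is divisibility by the equation. -/
theorem exists_dvd_of_not_anisotropic_functionField {φ : QuadraticForm F W}
    {b : Module.Basis ι F W} [IsDomain (MvPolynomial ι F ⧸ quadricIdeal φ b)]
    (hI : quadricIdeal φ b = Ideal.span {toPoly φ b}) {m : ℕ}
    {e : Module.Basis (Fin (m + 1)) F W} {c : Fin (m + 1) → F} (he : IsDiagonal φ e c)
    {J : Type*} [Fintype J] {d : J → F}
    (hd : ¬DiagAnisotropic (algebraMap F (FunctionField φ b) ∘ d)) :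
    ∃ v : J → MvPolynomial (Fin (m + 1)) F,
      diag (MvPolynomial.C ∘ c) MvPolynomial.X MvPolynomial.X ∣ diag (MvPolynomial.C ∘ d) v v ∧
      ¬∀ j, diag (MvPolynomial.C ∘ c) MvPolynomial.X MvPolynomial.X ∣ v j := by
  simp only [DiagAnisotropic, not_forall] at hd
  obtain ⟨z, hz, hz0⟩ := hd
  obtain ⟨x, h, h0, hx⟩ :=
    exists_common_denominator (R := MvPolynomial ι F ⧸ quadricIdeal φ b) z
  choose v hv using fun j => Ideal.Quotient.mk_surjective (x j)
  let π := (algebraMap (MvPolynomial ι F ⧸ quadricIdeal φ b) (FunctionField φ b)).comp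
    (Ideal.Quotient.mk _)
  have hπ : ∀ p, π p = 0 ↔ toPoly φ b ∣ p := algebraMap_mk_eq_zero_iff hI
  have hπv : π ∘ v = algebraMap _ (FunctionField φ b) h • z := funext fun j => by
    rw [Pi.smul_apply, smul_eq_mul, ← hx j, ← hv j]; rfl
  have hd1 : toPoly φ b ∣ diag (MvPolynomial.C ∘ d) v v := by
    rw [← hπ, map_diag, hπv, diag_smul_left, diag_smul_right]
    have : π ∘ MvPolynomial.C ∘ d = algebraMap F (FunctionField φ b) ∘ d := rfl
    rw [this, hz, mul_zero, mul_zero]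
  have hd2 : ¬∀ j, toPoly φ b ∣ v j := fun hall => hz0 (funext fun j => by
    have h1 := congrFun hπv j
    rw [Function.comp_apply, (hπ _).mpr (hall j), Pi.smul_apply, smul_eq_mul] at h1
    have := (mul_eq_zero.mp h1.symm).resolve_left fun h2 =>
      h0 ((map_eq_zero_iff _ (IsFractionRing.injective _ _)).mp h2)
    exact this)
  have hC : coordChange b e ∘ MvPolynomial.C ∘ d = MvPolynomial.C ∘ d :=
    funext fun j => MvPolynomial.algHom_C (coordChange b e) _
  have hΦ : coordChange b e (toPoly φ b) =
      diag (MvPolynomial.C ∘ c) MvPolynomial.X MvPolynomial.X := by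
    rw [← coordChange_diag he b, coordChange_coordChange]
  refine ⟨coordChange b e ∘ v, ?_, fun hall => hd2 fun j => ?_⟩
  · have h1 := map_dvd (coordChange b e) hd1
    rwa [hΦ, map_diag, hC] at h1
  · have h1 := map_dvd (coordChange e b) (hall j)
    rwa [coordChange_diag he, Function.comp_apply, coordChange_coordChange] at h1

end FunctionField

/-! ### Comparison of length and level -/

section Level

variable {F V W : Type*} [Field F] [AddCommGroup V] [Module F V] [AddCommGroup W] [Module F W]

theorem level_le {R M : Type*} [CommRing R] [AddCommGroup M] [Module R M] {q : QuadraticForm R M}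
    {n : ℕ} (hn : 0 < n) {v : Fin n → M} (hv : copies n q v = -1) : level q ≤ n :=
  iInf₂_le n ⟨hn, v, hv⟩

theorem formLength_le {q : QuadraticForm F V} {p : QuadraticForm F W} {n : ℕ}
    (h : IsSubform p (copies n q)) : formLength q p ≤ n :=
  iInf₂_le n h

theorem exists_isSubform_of_formLength_eq {q : QuadraticForm F V} {p : QuadraticForm F W} {n : ℕ}
    (h : formLength q p = n) : ∃ k ≤ n, IsSubform p (copies k q) := by
  have hlt : formLength q p < ((n + 1 : ℕ) : ℕ∞) := by
    rw [h]; exact_mod_cast Nat.lt_succ_self n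
  simp only [formLength, iInf_lt_iff] at hlt
  obtain ⟨k, hk, hkn⟩ := hlt
  exact ⟨k, Nat.lt_succ_iff.mp (by exact_mod_cast hkn), hk⟩

theorem smul_anisotropic {φ : QuadraticForm F W} (hφ : φ.Anisotropic) {a : F} (ha : a ≠ 0) :
    (a • φ).Anisotropic := fun w hw =>
  hφ w ((mul_eq_zero.mp hw).resolve_left ha)

theorem pfisterCoeff_ne_zero (l : List Fˣ) (i : PfisterIndex l) : pfisterCoeff l i ≠ 0 := by
  induction l with
  | nil => exact one_ne_zero
  | cons a l ih =>
    rcases i with i | i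
    · exact ih i
    · exact mul_ne_zero a.ne_zero (ih i)

variable [Invertible (2 : F)]

theorem IsDiagonal.smul {J : Type*} {φ : QuadraticForm F W} {e : Module.Basis J F W} {c : J → F}
    (h : IsDiagonal φ e c) (a : F) : IsDiagonal (a • φ) e (a • c) :=
  ⟨fun j => by simp [h.1], fun i j hij => by
    rw [map_smul, LinearMap.smul_apply, LinearMap.smul_apply, h.2 i j hij, smul_zero]⟩

theorem IsDiagonal.exists_copies_eq_iff {J : Type*} [Fintype J] {q : QuadraticForm F V}
    {v : Module.Basis J F V} {d : J → F} (h : IsDiagonal q v d) (n : ℕ) (b : F) :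
    (∃ x, PfisterLevel.copies n q x = b) ↔ ∃ y, diag (d ∘ Prod.snd (α := Fin n)) y y = b := by
  constructor
  · rintro ⟨x, hx⟩
    exact ⟨_, by rw [← hx, (h.copies n).apply]⟩
  · rintro ⟨y, hy⟩
    exact ⟨_, ((h.copies n).apply_sum y).trans hy⟩

theorem neg_one_represented_iff {J E : Type*} [Fintype J] [Field E] [Algebra F E]
    {q : QuadraticForm F V} {v : Module.Basis J F V} {d : J → F} (h : IsDiagonal q v d) (n : ℕ) :
    (∃ x, copies n (q.baseChange E) x = -1) ↔
      ∃ y, diag (algebraMap F E ∘ d ∘ Prod.snd (α := Fin n)) y y = -1 := by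
  let _ : Invertible (2 : E) := (Invertible.map (algebraMap F E) 2).copy 2 (map_ofNat _ _).symm
  exact (h.baseChange (A := E)).exists_copies_eq_iff n (-1)

variable [FiniteDimensional F V] {q : QuadraticForm F V} {φ : QuadraticForm F W}

/-- In dimension one `a = c₀ w²`, so `a c₀` is the square of `c₀ w`. Thus `a φ ≃ ⟨1⟩`, which is
contained in `q`. -/
theorem formLength_le_one {l : List Fˣ} {v : Module.Basis (PfisterIndex l) F V}
    (hv : IsDiagonal q v (pfisterCoeff l)) (hφ : φ.Anisotropic) {e : Module.Basis (Fin 1) F W}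
    {c : Fin 1 → F} (he : IsDiagonal φ e c) {a : F} (ha : a ∈ valueSet φ) :
    formLength q (a • φ) ≤ 1 := by
  obtain ⟨ha0, w, hw⟩ := ha
  obtain ⟨x, hx⟩ := pfisterCoeff_represents_one l
  have hx' : diag (pfisterCoeff l ∘ Prod.snd (α := Fin 1)) (x ∘ Prod.snd) (x ∘ Prod.snd) = 1 := by
    rw [← hx]
    exact diag_comp_equiv (Equiv.uniqueProd _ (Fin 1)) (pfisterCoeff l) x x
  rw [he.apply] at hw
  refine formLength_le (n := 1) (isSubform_of_orthogonal (he.smul a) (smul_anisotropic hφ ha0)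
    (hv.copies 1) (fun p => pfisterCoeff_ne_zero l p.2)
    (fun _ => (c 0 * e.equivFun w 0) • (x ∘ Prod.snd)) (fun i => ?_)
    fun i j hij => (hij (Subsingleton.elim i j)).elim)
  rw [diag_smul_left, diag_smul_right, hx', Subsingleton.elim i 0, Pi.smul_apply, smul_eq_mul,
    ← hw]
  simp only [diag, Finset.univ_unique, Finset.sum_singleton, Fin.default_eq_zero]
  ring

/-- Let `K` be an extension of `F` over which the form `φ` is isotropic, such that an isotropic
diagonal form over `K` comes from a vector of polynomials witnessing isotropy over the function
field of `φ`. Then the `q`-level of `K` is determined by the `q`-length of `a φ`. -/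
theorem level_baseChange_eq {E : Type*} [Field E] [Algebra F E] (hq : IsPfister q)
    (hφ : φ.Anisotropic) {m : ℕ} {e : Module.Basis (Fin (m + 1)) F W} {c : Fin (m + 1) → F}
    (he : IsDiagonal φ e c)
    (hdim : (Module.finrank F W : ℕ∞) ≤ level q * (Module.finrank F V : ℕ∞))
    {a : F} (ha : a ∈ valueSet φ) {n r : ℕ} (hlen : formLength q (a • φ) = (n : ℕ∞))
    (hlow : 2 ^ r < n) (hup : n ≤ 2 ^ (r + 1))
    (hiso : ∃ y : Fin (m + 1) → E, y ≠ 0 ∧ diag (algebraMap F E ∘ c) y y = 0)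
    (hdvd : ∀ {J : Type} [Fintype J] (d : J → F), ¬DiagAnisotropic (algebraMap F E ∘ d) →
      ∃ v : J → MvPolynomial (Fin (m + 1)) F,
        diag (MvPolynomial.C ∘ c) MvPolynomial.X MvPolynomial.X ∣ diag (MvPolynomial.C ∘ d) v v ∧
        ¬∀ j, diag (MvPolynomial.C ∘ c) MvPolynomial.X MvPolynomial.X ∣ v j) :
    level (q.baseChange E) = ((2 ^ r : ℕ) : ℕ∞) := by
  obtain ⟨l, v, hv⟩ := hq.exists_isDiagonal
  obtain ⟨ha0, w₀, hw₀⟩ := ha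
  have h2 : (2 : F) ≠ 0 := Invertible.ne_zero 2
  have h2E : (2 : E) ≠ 0 := by
    rw [← map_ofNat (algebraMap F E)]
    exact (map_ne_zero _).mpr h2
  have hc : ∀ i, c i ≠ 0 := fun i hi => e.ne_zero i (hφ _ (by rw [he.1, hi]))
  have hd0 := pfisterCoeff_ne_zero l
  have hroundF : DiagRound (pfisterCoeff l) := diagRound_pfisterCoeff (RingHom.id F) l
  have hroundE : DiagRound (algebraMap F E ∘ pfisterCoeff l) :=
    diagRound_pfisterCoeff (algebraMap F E) l
  have haφ := smul_anisotropic hφ ha0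
  have hnot : ∀ k ≤ 2 ^ r, ¬IsSubform (a • φ) (copies k q) := fun k hk h => by
    have h1 := formLength_le h
    rw [hlen] at h1
    have : n ≤ k := by exact_mod_cast h1
    omega
  refine le_antisymm ?_ ?_
  · obtain ⟨k, hkn, hk⟩ := exists_isSubform_of_formLength_eq hlen
    obtain ⟨g, hg, hgo⟩ := hk.exists_orthogonal (he.smul a) (hv.copies k)
    obtain ⟨y, hy0, hy⟩ := hiso
    have hnotk : ¬DiagAnisotropic ((algebraMap F E ∘ pfisterCoeff l) ∘ Prod.snd (α := Fin k)) := by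
      intro hk'
      -- The image of the isotropic vector `y` under the embedding of `a φ`. Its products with the
      -- images of the basis vectors recover `y`, since the entries `a cᵢ` are nonzero, so it is
      -- nonzero as well.
      set z := ∑ i, y i • (algebraMap F E ∘ g i)
      have hgE : ∀ i j, diag (algebraMap F E ∘ pfisterCoeff l ∘ Prod.snd (α := Fin k))
          (algebraMap F E ∘ g i) (algebraMap F E ∘ g j) =
          algebraMap F E (diag (pfisterCoeff l ∘ Prod.snd) (g i) (g j)) := fun i j =>
        (map_diag (algebraMap F E) _ _ _).symm
      have hzg : ∀ i, diag (algebraMap F E ∘ pfisterCoeff l ∘ Prod.snd (α := Fin k))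
          (algebraMap F E ∘ g i) z = algebraMap F E (a * c i) * y i := fun i => by
        simp only [z, diag_sum_right, diag_smul_right, hgE]
        rw [Finset.sum_eq_single i (fun j _ hij => by rw [hgo i j hij.symm]; simp) (by simp), hg,
          Pi.smul_apply, smul_eq_mul, mul_comm]
      have hz : diag (algebraMap F E ∘ pfisterCoeff l ∘ Prod.snd (α := Fin k)) z z = 0 := by
        conv_lhs => enter [2]; simp only [z]
        simp only [diag_sum_left, diag_smul_left, hzg]
        rw [← mul_zero (algebraMap F E a), ← hy, diag, Finset.mul_sum]
        refine Finset.sum_congr rfl fun i _ => ?_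
        rw [map_mul, Function.comp_apply]
        ring
      have hz0 : z = 0 := hk' z hz
      refine hy0 (funext fun i => ?_)
      have := hzg i
      rw [hz0, diag_zero_right] at this
      exact (mul_eq_zero.mp this.symm).resolve_left
        ((map_ne_zero _).mpr (mul_ne_zero ha0 (hc i)))
    obtain ⟨x, hx⟩ := (neg_one_represented_iff (E := E) hv (2 ^ r)).mpr
      (hroundE.exists_diag_copies_eq_neg_one h2E (fun j => (map_ne_zero _).mpr (hd0 j)) r
        fun h => hnotk (h.of_copies_le (hkn.trans hup)))
    exact level_le (pow_pos two_pos r) hx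
  · refine le_iInf₂ fun k hk => ?_
    obtain ⟨hk0, hk1⟩ := hk
    by_contra hlt
    have hkr : k + 1 ≤ 2 ^ r := by
      have := not_le.mp hlt
      exact_mod_cast this
    obtain ⟨y, hy⟩ := (neg_one_represented_iff hv k).mp hk1
    obtain ⟨x₁, hx₁⟩ := pfisterCoeff_represents_one l
    -- One more copy of `q` supplies the value `1` that cancels `-1`.
    have hE : ¬DiagAnisotropic
        (algebraMap F E ∘ pfisterCoeff l ∘ Prod.snd (α := Fin (2 ^ r))) := fun h =>
      not_diagAnisotropic_copies_succ (d := algebraMap F E ∘ pfisterCoeff l) hy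
        (x₁ := algebraMap F E ∘ x₁) (by rw [← map_diag, hx₁, map_one])
        (DiagAnisotropic.of_copies_le hkr h)
    by_cases hF : DiagAnisotropic (pfisterCoeff l ∘ Prod.snd (α := Fin (2 ^ r)))
    · obtain ⟨u, hu1, hu2⟩ := hdvd _ hE
      have hrep : RepresentsValues (pfisterCoeff l ∘ Prod.snd (α := Fin (2 ^ r))) ∅ (a • c) := by
        intro K _ _ hK w
        have hround : DiagRound (algebraMap F K ∘ pfisterCoeff l ∘ Prod.snd (α := Fin (2 ^ r))) :=
          (diagRound_pfisterCoeff (algebraMap F K) l).copies r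
        obtain ⟨x, hx⟩ := exists_diag_eq_of_dvd h2 (hc 0) u hu1 hu2 hK hround.exists_mul w
        -- A second application at `w₀`, where `φ(w₀) = a`, gives `c₀⁻¹ a`. The product with `c₀⁻¹
        -- c(w)`, scaled by `c₀²`, is `a c(w)`.
        obtain ⟨x', hx'⟩ := exists_diag_eq_of_dvd h2 (hc 0) u hu1 hu2 hK hround.exists_mul
          (algebraMap F K ∘ e.equivFun w₀)
        obtain ⟨z, hz⟩ := hround.exists_mul x' x
        refine ⟨algebraMap F K (c 0) • z, ?_, by simp⟩
        have hc0 : algebraMap F K (c 0) ≠ 0 := (map_ne_zero _).mpr (hc 0)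
        have hac : algebraMap F K ∘ (a • c) = algebraMap F K a • (algebraMap F K ∘ c) := by
          funext i; simp
        rw [diag_smul_left, diag_smul_right, hz, hx', hx, ← map_diag, ← he.apply, hw₀, hac,
          diag_smul_coeff]
        field_simp
      obtain ⟨g, hg, hgo, -⟩ := hrep.exists_orthogonal h2 hF
      exact hnot _ le_rfl (isSubform_of_orthogonal (he.smul a) haφ (hv.copies _)
        (fun p => hd0 p.2) g hg hgo)
    -- Here `2^r × q` is isotropic over `F`, and `r ≥ 1` because `0 < k` and `k + 1 ≤ 2^r`. The
    -- level over `F` is then at most `2^s`, so `dim φ` is at most half the dimension of the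
    -- hyperbolic form `2^r × q`.
    · obtain ⟨s, rfl⟩ : ∃ s, r = s + 1 :=
        Nat.exists_eq_succ_of_ne_zero (by rintro rfl; simp at hkr; omega)
      obtain ⟨x, hx⟩ := hroundF.exists_diag_copies_eq_neg_one h2 hd0 s hF
      obtain ⟨x', hx'⟩ := (hv.exists_copies_eq_iff (2 ^ s) (-1)).mpr ⟨x, hx⟩
      have hcard : m + 1 ≤ Fintype.card (Fin (2 ^ s) × PfisterIndex l) := by
        rw [Fintype.card_prod, Fintype.card_fin, ← Module.finrank_eq_card_basis v]
        have h1 := hdim.trans (mul_le_mul_left (level_le (pow_pos two_pos s) hx') _)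
        rw [Module.finrank_eq_card_basis e, Fintype.card_fin] at h1
        exact_mod_cast h1
      obtain ⟨g, hg, hgo⟩ := (hroundF.copies s).exists_orthogonal_of_neg_one h2
        (fun p => hd0 p.2) hx hcard (a • c)
      refine hnot (2 ^ s + 2 ^ s) (Nat.two_pow_succ s).ge
        (isSubform_of_orthogonal (he.smul a) haφ (hv.copies _) (fun p => hd0 p.2)
          (fun i => g i ∘ finAddProdEquiv _ _ _) (fun i => ?_) fun i j hij => ?_)
      · exact (diag_copies_add _ _ _ _ _).trans (hg i)
      · exact (diag_copies_add _ _ _ _ _).trans (hgo i j hij)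

end Level

/-! ### Diagonalization and the exclusion of degenerate cases -/

section Main

variable {F W : Type*} [Field F] [AddCommGroup W] [Module F W]

theorem exists_isDiagonal [Invertible (2 : F)] [FiniteDimensional F W] (φ : QuadraticForm F W) {d : ℕ}
    (hd : Module.finrank F W = d) :
    ∃ (e : Module.Basis (Fin d) F W) (c : Fin d → F), IsDiagonal φ e c := by
  subst hd
  obtain ⟨e, he⟩ := LinearMap.BilinForm.exists_orthogonal_basis
    (QuadraticForm.associated_isSymm F φ)
  exact ⟨e, _, fun _ => rfl, fun i j hij => he hij⟩

theorem not_equivalent_binary_one_neg_one_of_anisotropic {φ : QuadraticForm F W} (hφ : φ.Anisotropic) :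
    ¬φ.Equivalent (binary (1 : F) (-1)) := by
  rintro ⟨E⟩
  have h1 : φ (E.symm ![1, 1]) = 0 := by
    rw [E.symm.map_app]
    simp [binary]
  have h2 := hφ _ h1
  have h3 : (![1, 1] : Fin 2 → F) = 0 := by
    rw [← E.apply_symm_apply ![1, 1], h2]
    exact map_zero E.toLinearEquiv
  exact one_ne_zero (congrFun h3 0)

end Main

end PfisterLevel

end

theorem mainTheorem12 {F V W ι : Type*} [Field F] [Invertible (2 : F)]
    [AddCommGroup V] [Module F V] [FiniteDimensional F V]
    [AddCommGroup W] [Module F W] [Fintype ι]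
    (q : QuadraticForm F V) (hq : PfisterLevel.IsPfister q) (hqa : q.Anisotropic)
    (φ : QuadraticForm F W) (hφ : φ.Anisotropic) (b : Module.Basis ι F W)
    (hdim : (Module.finrank F W : ℕ∞) ≤ PfisterLevel.level q * (Module.finrank F V : ℕ∞))
    (a : F) (ha : a ∈ PfisterLevel.valueSet φ) (n r : ℕ)
    (hlen : PfisterLevel.formLength q (a • φ) = (n : ℕ∞))
    (hlow : 2 ^ r < n) (hup : n ≤ 2 ^ (r + 1)) :
    PfisterLevel.level (q.baseChange (PfisterLevel.FunctionField φ b)) = ((2 ^ r : ℕ) : ℕ∞) := by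
  have : FiniteDimensional F W := Module.Finite.of_basis b
  obtain ⟨ha0, w, hw⟩ := id ha
  have hw0 : w ≠ 0 := by
    rintro rfl
    exact ha0 (by rw [← hw, QuadraticMap.map_zero])
  have : Nontrivial W := nontrivial_of_ne w 0 hw0
  obtain ⟨m, hm⟩ := Nat.exists_eq_succ_of_ne_zero (Module.finrank_pos (R := F) (M := W)).ne'
  obtain ⟨e, c, he⟩ := PfisterLevel.exists_isDiagonal φ hm
  -- In dimension one the length is at most `1`, against `n > 2^r ≥ 1`; so the function field is
  -- that of an actual quadric.
  have hdim2 : 2 ≤ Module.finrank F W := by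
    rcases Nat.eq_zero_or_pos m with rfl | hm0
    · obtain ⟨l, v, hv⟩ := hq.exists_isDiagonal
      have h1 := PfisterLevel.formLength_le_one hv hφ he ha
      rw [hlen] at h1
      have h2 : n ≤ 1 := by exact_mod_cast h1
      have := Nat.one_le_two_pow (n := r)
      omega
    · omega
  have hI : PfisterLevel.quadricIdeal φ b = Ideal.span {PfisterLevel.toPoly φ b} :=
    if_pos ⟨hdim2, PfisterLevel.not_equivalent_binary_one_neg_one_of_anisotropic hφ⟩
  have := PfisterLevel.quadricIdeal_isPrime φ hφ b
  have : IsDomain (MvPolynomial ι F ⧸ PfisterLevel.quadricIdeal φ b) :=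
    Ideal.Quotient.isDomain _
  have hc0 : c 0 ≠ 0 := fun h0 => e.ne_zero 0 (hφ _ (by rw [he.1, h0]))
  exact PfisterLevel.level_baseChange_eq (E := PfisterLevel.FunctionField φ b) hq hφ he hdim ha
    hlen hlow hup (PfisterLevel.exists_zero_functionField hI he hc0)
    fun d hd => PfisterLevel.exists_dvd_of_not_anisotropic_functionField hI he hd
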